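/- Let $\mathbb N=\{1,2,3,\dots\}$. A composition is a finite non-empty sequence $\mathbf k=(k_1,\dots,k_r)$ of positive integers; put $|\mathbf k|=k_1+\cdots+k_r$, $\overleftarrow{\mathbf k}=(k_r,\dots,k_1)$ and $\mathbf k_+=(k_1+1,k_2,\dots,k_r)$. The Hoffman dual $\mathbf k^\vee$ is the composition of $|\mathbf k|$ obtained by writing $\mathbf k=(1+\cdots+1,\dots,1+\cdots+1)$, with $k_i$ ones in the $i$-th entry, and interchanging commas and plus signs. For a composition $\mathbf m=(m_1,\dots,m_n)$ and $\mathbf j=(j_1,\dots,j_n)$ with integers $j_i\ge 0$ put $$B(\mathbf m;\mathbf j)=\prod_{i=1}^n\binom{m_i+j_i-1}{j_i},$$ $|\mathbf j|=j_1+\cdots+j_n$, and let $\mathbf m+\mathbf j$ be the componentwise sum. For $0\le x<1$ let $$\mathrm{Li}_{\mathbf k}(x)=\sum_{n_1>\cdots>n_r>0}\frac{x^{n_1}}{n_1^{k_1}\cdots n_r^{k_r}},\qquad \mathrm A(\mathbf k;x)=2^r\sum_{m_1>\cdots>m_r>0}\frac{x^{2m_1-r}}{(2m_1-r)^{k_1}(2m_2-r+1)^{k_2}\cdots(2m_r-1)^{k_r}},$$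 and for a composition $\mathbf m=(m_1,\dots,m_n)$ with $m_1>1$ and $a\in\mathbb C\setminus\{0,-1,-2,\dots\}$ let $$\zeta(\mathbf m;a)=\lim_{N\to\infty}\ \sum_{N\ge n_1>\cdots>n_n>0}\ \prod_{i=1}^n\frac1{(n_i+a-1)^{m_i}},\qquad T(\mathbf m;a)=\sum_{l_1>\cdots>l_n>0}\ \prod_{i=1}^n\frac{2}{(2l_i-n-2+i+a)^{m_i}}.$$ **Theorem.** Let $\mathbf k=(k_1,\dots,k_r)$ be a composition, $k\in\mathbb N$, $n=|\mathbf k|+1-r$, and $\mathbf m=(\overleftarrow{\mathbf k}^\vee)_+$ (a composition with $n$ entries). The two integrals $$I(\alpha)=\int_0^1\frac{\mathrm{Li}_{\mathbf k}(x)\log^k(1-x)}{x(1-x)^\alpha}\,dx,\qquad J(\alpha)=\int_0^1\frac{\mathrm A(\mathbf k;x)\log^k\!\left(\frac{1-x}{1+x}\right)}{x\left(\frac{1-x}{1+x}\right)^\alpha}\,dx$$ converge absolutely for $\mathrm{Re}(\alpha)<1$, and, as functions of $\alpha$, extend to holomorphic functions on $\mathbb C\setminus\mathbb N$ (again denoted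 by $I$ and $J$). For every $\alpha\in\mathbb C\setminus\mathbb N$ the limits $\zeta(\mathbf m+\mathbf j;1-\alpha)$ exist and the series $T(\mathbf m+\mathbf j;1-\alpha)$ converge absolutely, for all $\mathbf j\in\mathbb Z_{\ge0}^n$ with $|\mathbf j|=k$, and $$I(\alpha)=(-1)^kk!\sum_{\mathbf j\in\mathbb Z_{\ge0}^n,\ |\mathbf j|=k}B(\mathbf m;\mathbf j)\,\zeta(\mathbf m+\mathbf j;1-\alpha),\qquad J(\alpha)=(-1)^kk!\sum_{\mathbf j\in\mathbb Z_{\ge0}^n,\ |\mathbf j|=k}B(\mathbf m;\mathbf j)\,T(\mathbf m+\mathbf j;1-\alpha).$$ In particular, for $\mathrm{Re}(\alpha)<1$ these formulas evaluate the convergent integrals themselves. -/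

import Mathlib

open Filter Topology MeasureTheory

noncomputable section

/-- The operation `k₊`: `(k₁, k₂, …, k_r) ↦ (k₁ + 1, k₂, …, k_r)`. -/
def incHead : List ℕ → List ℕ
  | [] => []
  | k :: ks => (k + 1) :: ks

/-- Write `k = (1 + ⋯ + 1, …, 1 + ⋯ + 1)` with `k_i` ones in the `i`-th entry, and record the
sequence of the `|k| - 1` separators between consecutive ones: `true` for a plus sign and `false`
for a comma. -/
def separators (ks : List ℕ) : List Bool :=
  [false].intercalate (ks.map fun k => List.replicate (k - 1) true)

/-- The composition of `s.length + 1` with the given sequence of separators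
(`true` is a plus sign, `false` a comma). -/
def ofSeparators : List Bool → List ℕ
  | [] => [1]
  | true :: s => incHead (ofSeparators s)
  | false :: s => 1 :: ofSeparators s

/-- The Hoffman dual `k^∨` of a composition: plus signs and commas are swapped. Equivalently,
the proper partial sums of `k` and of `k^∨` partition `{1, …, |k| - 1}`. -/
def hoffmanDual : List ℕ → List ℕ
  | [] => []
  | k :: ks => ofSeparators ((separators (k :: ks)).map not)

/-- `B(k; j) = ∏ᵢ binom(kᵢ + jᵢ - 1, jᵢ)` for two lists of the same length. -/
def multiBinom (ks js : List ℕ) : ℕ :=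
  (List.zipWith (fun k j => (k + j - 1).choose j) ks js).prod

/-- The componentwise sum of two lists of the same length. -/
def addLists (ks js : List ℕ) : List ℕ :=
  List.zipWith (· + ·) ks js

/-- The `r`-tuples of integers with `n₁ > n₂ > ⋯ > n_r > 0`. -/
abbrev DecTuple (r : ℕ) : Type :=
  {n : Fin r → ℕ // StrictAnti n ∧ ∀ i, 0 < n i}

/-- The multiple polylogarithm in several variables,
`Li_k(x₁, …, x_r) = ∑_{n₁ > ⋯ > n_r > 0} ∏ᵢ xᵢ^{nᵢ} / nᵢ^{kᵢ}`. -/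
def multiPolylog (ks : List ℕ) (x : Fin ks.length → ℝ) : ℝ :=
  ∑' n : DecTuple ks.length, ∏ i, x i ^ n.1 i / (n.1 i : ℝ) ^ ks.get i

/-- The multiple polylogarithm in one variable, `Li_k(x) = Li_k(x, 1, …, 1)`. -/
def polylog (ks : List ℕ) (x : ℝ) : ℝ :=
  multiPolylog ks fun i => if (i : ℕ) = 0 then x else 1

/-- The Kaneko–Tsumura function
`A(k; x) = 2^r ∑_{m₁ > ⋯ > m_r > 0}
  x^{2m₁ - r} / ((2m₁ - r)^{k₁} (2m₂ - r + 1)^{k₂} ⋯ (2m_r - 1)^{k_r})`.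
The index `i` is counted from `0`. The subtraction in the exponent is one of natural numbers;
it does not truncate since `m₁ ≥ r`. -/
def kanekoTsumuraA (ks : List ℕ) (x : ℝ) : ℝ :=
  2 ^ ks.length * ∑' m : DecTuple ks.length,
    ∏ i : Fin ks.length, (if (i : ℕ) = 0 then x ^ (2 * m.1 i - ks.length) else 1) /
      (2 * (m.1 i : ℝ) - (ks.length : ℝ) + ((i : ℕ) : ℝ)) ^ ks.get i

open Classical in
/-- The Hurwitz-type multiple harmonic sum
`ζ_N(k; a) = ∑_{N ≥ n₁ > ⋯ > n_r > 0} ∏ᵢ 1 / (nᵢ + a - 1)^{kᵢ}`. -/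
def hurwitzHarmonicSum (ks : List ℕ) (a : ℂ) (N : ℕ) : ℂ :=
  ∑ n ∈ (Fintype.piFinset fun _ : Fin ks.length => Finset.Icc 1 N) with StrictAnti n,
    ∏ i, 1 / ((n i : ℂ) + a - 1) ^ ks.get i

/-- The Hurwitz-type multiple zeta value `ζ(k; a) = lim_{N → ∞} ζ_N(k; a)`. -/
def hurwitzMZV (ks : List ℕ) (a : ℂ) : ℂ :=
  limUnder atTop (hurwitzHarmonicSum ks a)

/-- The general term of the series `T(k; a)`:
`2^r / ((2m₁ - r - 1 + a)^{k₁} (2m₂ - r + a)^{k₂} ⋯ (2m_r - 2 + a)^{k_r})`,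
with the index `i` counted from `0`. -/
def hurwitzMTVTerm (ks : List ℕ) (a : ℂ) (m : DecTuple ks.length) : ℂ :=
  2 ^ ks.length /
    ∏ i : Fin ks.length, (2 * (m.1 i : ℂ) - (ks.length : ℂ) - 1 + ((i : ℕ) : ℂ) + a) ^ ks.get i

/-- The Hurwitz-type multiple `T`-value `T(k; a)`, a sum over `m₁ > ⋯ > m_r > 0`. -/
def hurwitzMTV (ks : List ℕ) (a : ℂ) : ℂ :=
  ∑' m : DecTuple ks.length, hurwitzMTVTerm ks a m

/-- The integrand `Li_k(x) log^k(1 - x) / (x (1 - x)^α)`. -/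
def polylogIntegrand (ks : List ℕ) (k : ℕ) (α : ℂ) (x : ℝ) : ℂ :=
  (polylog ks x : ℂ) * (Real.log (1 - x) : ℂ) ^ k / ((x : ℂ) * ((1 - x : ℝ) : ℂ) ^ α)

/-- The integrand `A(k; x) log^k((1 - x)/(1 + x)) / (x ((1 - x)/(1 + x))^α)`. -/
def kanekoTsumuraIntegrand (ks : List ℕ) (k : ℕ) (α : ℂ) (x : ℝ) : ℂ :=
  (kanekoTsumuraA ks x : ℂ) * (Real.log ((1 - x) / (1 + x)) : ℂ) ^ k /
    ((x : ℂ) * (((1 - x) / (1 + x) : ℝ) : ℂ) ^ α)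

/-- The set `ℂ ∖ {1, 2, 3, …}`. -/
def complexMinusPosNat : Set ℂ := {α | ∀ n : ℕ, 0 < n → α ≠ (n : ℂ)}

end

/-! Both formulas are one statement with a parameter `d`: `d = 1` gives `Li` and `ζ`, `d = 2` gives
`A` and `T`. On `(0, 1)` the function `L = Li_k` or `A(k; ·)` is an iterated integral of `1` along
the word of `k` in the forms `dx / x` and `d dx / (1 - x ^ d)`. The involution `τ(x) = 1 - x`,
respectively `(1 - x) / (1 + x)`, satisfies `d log τ = -d dx / (1 - x ^ d)`, so it exchanges the two
forms up to sign and reverses the order.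

Substitute `τ` in `∫ L(x) τ(x) ^ z dx / x` and move the letters of the word across one at a time by
Tonelli (`lintegral_transport`). The result is the iterated integral up to `1` of `t ^ z` along the
reversed word with letters exchanged, followed by one letter `d dx / (1 - x ^ d)`. This is the word
of `m` (`indexWord_incHead_hoffmanDual`). Geometric series turn it into the Hurwitz nested sum `S(m;
a)` at `a = 1 + z` (`iteratedIntegral_indexWord`). For real `z > -1` all terms are nonnegative, so
interchanges are free, and finiteness of the sum gives integrability.

Thus `S(m; 1 + z)` is the moment generating function of `log τ` for the measure `L(x) dx / x`. Both
sides are analytic on `Re z > -1`, so they agree there (`complexMGF_eq`). Differentiating `k` times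
produces `log ^ k τ` on one side; on the other, the Leibniz rule gives `(-1) ^ k k! ∑ B(m; j) S(m +
j; 1 + z)`. Put `z = -α`. The nested sums converge locally uniformly in `a` away from `0, -1, -2,
…`, which provides the continuation. -/

/-! ### Nested sums with step `d` and sums over decreasing tuples -/

/-- The `N`-th exponent at depth `r`: consecutive ones differ by `1` modulo `d`. -/
def stepExponent (R : Type*) [Ring R] (d r N : ℕ) : R := (d : R) * N - ((d : R) - 1) * r

/-- The part of the nested sum with step `d` whose outermost summation index equals `N`. -/
def nestedCoeff {R : Type*} [Field R] (d : ℕ) : List ℕ → R → ℕ → R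
  | [], _, N => if N = 0 then 1 else 0
  | m :: ms, a, N => (d : R) / (stepExponent R d (ms.length + 1) N + a - 1) ^ m *
      ∑ M ∈ Finset.range N, nestedCoeff d ms a M

/-- The `i`-th factor of the general term of the nested sum with step `d`. -/
def nestedFactor {R : Type*} [Field R] (d : ℕ) (ms : List ℕ) (a : R) (i : Fin ms.length) (n : ℕ) :
    R :=
  (d : R) / (stepExponent R d (ms.length - i) n + a - 1) ^ ms.get i

open Classical in
/-- The tuples with entries in `{1, …, N}`, among all decreasing tuples. -/
def boundedDecTuples (r N : ℕ) : Finset (DecTuple r) :=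
  (Fintype.piFinset fun _ : Fin r => Finset.Icc 1 N).subtype
    fun n => StrictAnti n ∧ ∀ i, 0 < n i

/-- The sum of `∏ᵢ gᵢ(nᵢ)` over `N ≥ n₁ > ⋯ > n_r > 0`. -/
def decSum {R : Type*} [CommSemiring R] (r : ℕ) (g : Fin r → ℕ → R) (N : ℕ) : R :=
  ∑ n ∈ boundedDecTuples r N, ∏ i, g i (n.1 i)

theorem mem_boundedDecTuples {r N : ℕ} {n : DecTuple r} :
    n ∈ boundedDecTuples r N ↔ ∀ i, n.1 i ≤ N := by
  have := n.2.2
  simp only [boundedDecTuples, Finset.mem_subtype, Fintype.mem_piFinset, Finset.mem_Icc]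
  exact forall_congr' fun i => ⟨fun h => h.2, fun h => ⟨this i, h⟩⟩

theorem strictAnti_cons_iff {r M : ℕ} {t : Fin r → ℕ} :
    StrictAnti (Fin.cons M t : Fin (r + 1) → ℕ) ↔ (∀ i, t i < M) ∧ StrictAnti t := by
  constructor
  · intro h
    exact ⟨fun i => by simpa using h (Fin.succ_pos i),
      fun i j hij => by simpa using h (Fin.succ_lt_succ_iff.2 hij)⟩
  · rintro ⟨h1, h2⟩ i j hij
    cases i using Fin.cases with
    | zero =>
      cases j using Fin.cases with
      | zero => exact absurd hij (lt_irrefl _)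
      | succ j => simpa using h1 j
    | succ i =>
      cases j using Fin.cases with
      | zero => exact absurd hij (Fin.not_lt_zero _)
      | succ j => simpa using h2 (Fin.succ_lt_succ_iff.1 hij)

theorem decSum_succ {R : Type*} [CommSemiring R] (r : ℕ) (g : Fin (r + 1) → ℕ → R) (N : ℕ) :
    decSum (r + 1) g N =
      ∑ M ∈ Finset.Icc 1 N, g 0 M * decSum r (fun i => g i.succ) (M - 1) := by
  simp only [decSum, Finset.mul_sum]
  rw [Finset.sum_sigma']
  refine Finset.sum_bij' (fun n _ => ⟨n.1 0, ⟨fun i => n.1 i.succ,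
      fun i j hij => n.2.1 (Fin.succ_lt_succ_iff.2 hij), fun i => n.2.2 _⟩⟩)
    (fun p hp => ⟨Fin.cons p.1 p.2.1, ?_⟩) ?_ ?_ ?_ ?_ ?_
  · simp only [Finset.mem_sigma, Finset.mem_Icc, mem_boundedDecTuples] at hp
    refine ⟨strictAnti_cons_iff.2 ⟨fun i => ?_, p.2.2.1⟩, fun i => ?_⟩
    · have := hp.2 i
      omega
    · cases i using Fin.cases with
      | zero => exact hp.1.1
      | succ i => simpa using p.2.2.2 i
  · intro n hn
    rw [mem_boundedDecTuples] at hn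
    simp only [Finset.mem_sigma, Finset.mem_Icc, mem_boundedDecTuples]
    refine ⟨⟨n.2.2 0, hn 0⟩, fun i => ?_⟩
    have := n.2.1 (Fin.succ_pos i)
    omega
  · intro p hp
    simp only [Finset.mem_sigma, Finset.mem_Icc, mem_boundedDecTuples] at hp ⊢
    intro i
    cases i using Fin.cases with
    | zero => simpa using hp.1.2
    | succ i =>
      have := hp.2 i
      simp only [Fin.cons_succ]
      omega
  · intro n hn
    ext i
    cases i using Fin.cases <;> simp
  · rintro ⟨M, t⟩ hp
    simp
  · intro n hn
    simp [Fin.prod_univ_succ]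

theorem decSum_zero {R : Type*} [CommSemiring R] (g : Fin 0 → ℕ → R) (N : ℕ) :
    decSum 0 g N = 1 := by
  have : boundedDecTuples 0 N = Finset.univ := by
    ext n
    simp [mem_boundedDecTuples]
  have hc : Fintype.card (DecTuple 0) = 1 := by
    rw [Fintype.card_eq_one_iff]
    exact ⟨⟨Fin.elim0, fun i => i.elim0, fun i => i.elim0⟩, fun n => by ext i; exact i.elim0⟩
  simp [decSum, this, hc]

theorem sum_Icc_one_eq_sum_range {R : Type*} [AddCommMonoid R] (f : ℕ → R) (h0 : f 0 = 0) (N : ℕ) :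
    ∑ M ∈ Finset.Icc 1 N, f M = ∑ M ∈ Finset.range (N + 1), f M := by
  refine Finset.sum_subset (fun i hi => ?_) fun i hi hi' => ?_
  · simp only [Finset.mem_Icc, Finset.mem_range] at *
    omega
  · simp only [Finset.mem_Icc, Finset.mem_range] at *
    have : i = 0 := by omega
    rw [this, h0]

theorem nestedCoeff_cons_zero {R : Type*} [Field R] (d m : ℕ) (ms : List ℕ) (a : R) :
    nestedCoeff d (m :: ms) a 0 = 0 := by
  simp [nestedCoeff]

theorem nestedFactor_succ {R : Type*} [Field R] (d m : ℕ) (ms : List ℕ) (a : R)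
    (i : Fin ms.length) (n : ℕ) :
    nestedFactor d (m :: ms) a i.succ n = nestedFactor d ms a i n := by
  simp [nestedFactor]

/-- The weight `φ` sees only the outermost index: `φ = 1` drives the induction on depth, and a power
of `x` gives the functions of one variable. The unweighted case for the tail is a hypothesis so that
this one computation serves both. -/
theorem decSum_weighted_nestedFactor_of {R : Type*} [Field R] (d m : ℕ) (ms : List ℕ) (a : R)
    (h : ∀ N, decSum ms.length (nestedFactor d ms a) N =
      ∑ M ∈ Finset.range (N + 1), nestedCoeff d ms a M)
    (φ : ℕ → R) (N : ℕ) :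
    decSum (m :: ms).length
        (fun i n => (if (i : ℕ) = 0 then φ n else 1) * nestedFactor d (m :: ms) a i n) N =
      ∑ M ∈ Finset.range (N + 1), φ M * nestedCoeff d (m :: ms) a M := by
  rw [← sum_Icc_one_eq_sum_range _ (by simp [nestedCoeff_cons_zero])]
  refine (decSum_succ ms.length _ N).trans (Finset.sum_congr rfl fun M hM => ?_)
  have hM' : M - 1 + 1 = M := by
    rw [Finset.mem_Icc] at hM
    omega
  simp only [Fin.val_succ, Nat.succ_ne_zero, if_false, one_mul, nestedFactor_succ]
  rw [h, hM']
  simp [nestedFactor, nestedCoeff, mul_assoc]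

theorem decSum_nestedFactor {R : Type*} [Field R] (d : ℕ) (ms : List ℕ) (a : R) (N : ℕ) :
    decSum ms.length (nestedFactor d ms a) N =
      ∑ M ∈ Finset.range (N + 1), nestedCoeff d ms a M := by
  induction ms generalizing N with
  | nil =>
    rw [show decSum (List.length []) (nestedFactor d [] a) N = 1 from decSum_zero _ N]
    simp [nestedCoeff]
  | cons m ms ih =>
    simpa using decSum_weighted_nestedFactor_of d m ms a ih (fun _ => 1) N

theorem decSum_weighted_nestedFactor {R : Type*} [Field R] (d m : ℕ) (ms : List ℕ) (a : R)
    (φ : ℕ → R) (N : ℕ) :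
    decSum (m :: ms).length
        (fun i n => (if (i : ℕ) = 0 then φ n else 1) * nestedFactor d (m :: ms) a i n) N =
      ∑ M ∈ Finset.range (N + 1), φ M * nestedCoeff d (m :: ms) a M :=
  decSum_weighted_nestedFactor_of d m ms a (decSum_nestedFactor d ms a) φ N

theorem tendsto_boundedDecTuples (r : ℕ) : Tendsto (boundedDecTuples r) atTop atTop := by
  refine tendsto_atTop_finset_of_monotone (fun N N' h n hn => ?_) fun n => ⟨∑ i, n.1 i, ?_⟩
  · rw [mem_boundedDecTuples] at *
    exact fun i => (hn i).trans h
  · rw [mem_boundedDecTuples]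
    exact fun i => Finset.single_le_sum (f := n.1) (fun _ _ => Nat.zero_le _) (Finset.mem_univ i)

theorem tendsto_decSum {𝕜 : Type*} [NormedField 𝕜] {r : ℕ} {g : Fin r → ℕ → 𝕜}
    (h : Summable fun n : DecTuple r => ∏ i, g i (n.1 i)) :
    Tendsto (decSum r g) atTop (𝓝 (∑' n : DecTuple r, ∏ i, g i (n.1 i))) :=
  h.hasSum.comp (tendsto_boundedDecTuples r)

/-- Every finite set of tuples lies in some box `{1, …, N}`, so for nonnegative terms convergence
over the outermost index bounds all finite sums over tuples. -/
theorem hasSum_decTuple_of_nonneg {r : ℕ} {g : Fin r → ℕ → ℝ} {c : ℕ → ℝ}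
    (h0 : ∀ n : DecTuple r, 0 ≤ ∏ i, g i (n.1 i)) (hc : ∀ N, 0 ≤ c N) (hs : Summable c)
    (h : ∀ N, decSum r g N = ∑ M ∈ Finset.range (N + 1), c M) :
    HasSum (fun n : DecTuple r => ∏ i, g i (n.1 i)) (∑' N, c N) := by
  have hsum : Summable fun n : DecTuple r => ∏ i, g i (n.1 i) := by
    refine summable_of_sum_le (c := ∑' N, c N) h0 fun u => ?_
    obtain ⟨N, hN⟩ := ((tendsto_boundedDecTuples r).eventually (eventually_ge_atTop u)).exists
    exact (Finset.sum_le_sum_of_subset_of_nonneg hN fun n _ _ => h0 n).trans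
      ((h N).trans_le (hs.sum_le_tsum _ fun M _ => hc M))
  have ht := tendsto_decSum hsum
  rw [funext h] at ht
  rw [tendsto_nhds_unique (hs.hasSum.tendsto_sum_nat.comp (tendsto_add_atTop_nat 1)) ht]
  exact hsum.hasSum

theorem hurwitzHarmonicSum_eq (ms : List ℕ) (a : ℂ) (N : ℕ) :
    hurwitzHarmonicSum ms a N = ∑ M ∈ Finset.range (N + 1), nestedCoeff 1 ms a M := by
  classical
  rw [← decSum_nestedFactor, decSum, boundedDecTuples,
    Finset.sum_subtype_eq_sum_filter (f := fun n : Fin ms.length → ℕ =>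
      ∏ i, nestedFactor 1 ms a i (n i)), hurwitzHarmonicSum]
  refine Finset.sum_congr ?_ fun n _ => Finset.prod_congr rfl fun i _ => ?_
  · ext n
    simp only [Finset.mem_filter, Fintype.mem_piFinset, Finset.mem_Icc]
    exact ⟨fun h => ⟨h.1, h.2, fun i => (h.1 i).1⟩, fun h => ⟨h.1, h.2.1⟩⟩
  · simp [nestedFactor, stepExponent]

theorem hurwitzMTVTerm_eq (ms : List ℕ) (a : ℂ) (n : DecTuple ms.length) :
    hurwitzMTVTerm ms a n = ∏ i, nestedFactor 2 ms a i (n.1 i) := by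
  simp only [hurwitzMTVTerm, nestedFactor, Finset.prod_div_distrib, Finset.prod_const,
    Finset.card_univ, Fintype.card_fin]
  congr 1
  refine Finset.prod_congr rfl fun i _ => ?_
  rw [stepExponent, Nat.cast_sub i.2.le]
  congr 1
  push_cast
  ring

/-! ### Size estimates and convergence -/

theorem stepExponent_eq_natCast {R : Type*} [Ring R] {d r N : ℕ} (hd : 0 < d) (h : r ≤ N) :
    stepExponent R d r N = ((N + (d - 1) * (N - r) : ℕ) : R) := by
  obtain ⟨e, rfl⟩ := Nat.exists_eq_add_of_le' hd
  obtain ⟨s, rfl⟩ := Nat.exists_eq_add_of_le h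
  simp only [stepExponent, Nat.add_sub_cancel, Nat.add_sub_cancel_left]
  push_cast
  noncomm_ring

/-- A strictly decreasing chain of positive integers needs an outermost index at least as large as
its length. Hence denominators matter only where the exponent is a positive integer. -/
theorem nestedCoeff_eq_zero {R : Type*} [Field R] (d : ℕ) (ms : List ℕ) (a : R) {N : ℕ}
    (h : N < ms.length) : nestedCoeff d ms a N = 0 := by
  induction ms generalizing N with
  | nil => simp at h
  | cons m ms ih =>
    rw [nestedCoeff, Finset.sum_eq_zero, mul_zero]
    intro M hM
    rw [Finset.mem_range] at hM
    rw [List.length_cons] at h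
    exact ih (by omega)

theorem nestedCoeff_nonneg {d : ℕ} (hd : 0 < d) (ms : List ℕ) {a : ℝ} (ha : 0 < a) (N : ℕ) :
    0 ≤ nestedCoeff d ms a N := by
  induction ms generalizing N with
  | nil => simp only [nestedCoeff]; split_ifs <;> simp
  | cons m ms ih =>
    by_cases h : N < ms.length + 1
    · rw [nestedCoeff_eq_zero _ _ _ h]
    · rw [nestedCoeff, stepExponent_eq_natCast hd (not_lt.1 h)]
      have : (1 : ℝ) ≤ ((N + (d - 1) * (N - (ms.length + 1)) : ℕ) : ℝ) := by
        exact_mod_cast (by omega : 1 ≤ N).trans (Nat.le_add_right _ _)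
      exact mul_nonneg (div_nonneg (Nat.cast_nonneg _) (pow_nonneg (by linarith) _))
        (Finset.sum_nonneg fun M _ => ih M)

theorem ofReal_nestedCoeff (d : ℕ) (ms : List ℕ) (a : ℝ) (N : ℕ) :
    ((nestedCoeff d ms a N : ℝ) : ℂ) = nestedCoeff d ms (a : ℂ) N := by
  induction ms generalizing N with
  | nil => simp only [nestedCoeff]; split_ifs <;> simp
  | cons m ms ih => simp [nestedCoeff, ih, stepExponent]

/-- Reduces convergence at complex `a` to the real case `a = 1`, with a constant uniform in `N`:
each of the `ms.sum` linear factors loses at most `1 / δ`. -/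
theorem norm_nestedCoeff_le {d : ℕ} (hd : 0 < d) (ms : List ℕ) {a : ℂ} {δ : ℝ} (hδ : 0 < δ)
    (h : ∀ q : ℕ, 1 ≤ q → δ * q ≤ ‖(q : ℂ) + a - 1‖) (N : ℕ) :
    ‖nestedCoeff d ms a N‖ ≤ (1 / δ) ^ ms.sum * nestedCoeff d ms (1 : ℝ) N := by
  induction ms generalizing N with
  | nil => simp only [nestedCoeff]; split_ifs <;> simp
  | cons m ms ih =>
    by_cases hN : N < ms.length + 1
    · rw [nestedCoeff_eq_zero _ _ _ hN, nestedCoeff_eq_zero _ _ _ hN]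
      simp
    · rw [nestedCoeff, nestedCoeff, stepExponent_eq_natCast hd (not_lt.1 hN),
        stepExponent_eq_natCast hd (not_lt.1 hN)]
      set q := N + (d - 1) * (N - (ms.length + 1))
      have hq : 1 ≤ q := (by omega : 1 ≤ N).trans (Nat.le_add_right _ _)
      have hq' : (0 : ℝ) < q := by exact_mod_cast hq
      rw [norm_mul, norm_div, norm_pow, List.sum_cons, pow_add, add_sub_cancel_right]
      have h1 : ‖(d : ℂ)‖ / ‖(q : ℂ) + a - 1‖ ^ m ≤ (1 / δ) ^ m * (d / (q : ℝ) ^ m) := by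
        rw [Complex.norm_natCast, one_div, inv_pow, inv_mul_eq_div, div_div, mul_comm, ← mul_pow]
        rw [mul_comm]
        gcongr
        simpa [mul_comm] using h q hq
      have h2 : ‖∑ M ∈ Finset.range N, nestedCoeff d ms a M‖ ≤
          (1 / δ) ^ ms.sum * ∑ M ∈ Finset.range N, nestedCoeff d ms (1 : ℝ) M := by
        rw [Finset.mul_sum]
        exact norm_sum_le_of_le _ fun M _ => ih M
      calc _ ≤ ((1 / δ) ^ m * (d / (q : ℝ) ^ m)) *
            ((1 / δ) ^ ms.sum * ∑ M ∈ Finset.range N, nestedCoeff d ms (1 : ℝ) M) := by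
              gcongr
        _ = _ := by ring

theorem sum_range_one_div_le (N : ℕ) : ∑ M ∈ Finset.range N, 1 / (M : ℝ) ≤ 1 + Real.log N := by
  cases N with
  | zero => simp
  | succ n =>
    rw [Finset.sum_range_succ']
    have h := harmonic_le_one_add_log n
    rw [harmonic] at h
    push_cast at h
    have h2 : Real.log n ≤ Real.log ((n + 1 : ℕ) : ℝ) := by
      rcases Nat.eq_zero_or_pos n with rfl | hn
      · simp
      · exact Real.log_le_log (by exact_mod_cast hn) (by simp)
    simp only [Nat.cast_zero, div_zero, add_zero]
    refine le_trans (le_of_eq ?_) (h.trans (by linarith))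
    simp

/-- The exponent is at least `N` wherever the coefficient is nonzero. Taking `p = 1` feeds the
logarithmic bound on partial sums, `p = 2` the convergence of admissible sums. -/
theorem nestedCoeff_cons_le {d : ℕ} (hd : 0 < d) {m p : ℕ} (hp : p ≤ m) (ms : List ℕ) {N : ℕ} {K : ℝ}
    (hK : ∑ M ∈ Finset.range N, nestedCoeff d ms (1 : ℝ) M ≤ K) :
    nestedCoeff d (m :: ms) (1 : ℝ) N ≤ d / (N : ℝ) ^ p * K := by
  have hs : 0 ≤ ∑ M ∈ Finset.range N, nestedCoeff d ms (1 : ℝ) M :=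
    Finset.sum_nonneg fun M _ => nestedCoeff_nonneg hd ms one_pos M
  by_cases h : N < ms.length + 1
  · rw [nestedCoeff_eq_zero _ _ _ h]
    have := hs.trans hK
    positivity
  · rw [nestedCoeff, stepExponent_eq_natCast hd (not_lt.1 h), add_sub_cancel_right]
    have h1 : (1 : ℝ) ≤ N := by exact_mod_cast (by omega : 1 ≤ N)
    have hq : (N : ℝ) ≤ ((N + (d - 1) * (N - (ms.length + 1)) : ℕ) : ℝ) := by
      exact_mod_cast Nat.le_add_right _ _
    have h2 : (N : ℝ) ^ p ≤ ((N + (d - 1) * (N - (ms.length + 1)) : ℕ) : ℝ) ^ m :=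
      (pow_le_pow_right₀ h1 hp).trans (pow_le_pow_left₀ (by linarith) hq m)
    have h3 : (0 : ℝ) < (N : ℝ) ^ p := by positivity
    gcongr

theorem one_add_log_nonneg (N : ℕ) : 0 ≤ 1 + Real.log N := by
  have := Real.log_natCast_nonneg N
  linarith

theorem sum_nestedCoeff_le {d : ℕ} (hd : 0 < d) {ms : List ℕ} (hms : ∀ i ∈ ms, 0 < i) (N : ℕ) :
    ∑ M ∈ Finset.range N, nestedCoeff d ms (1 : ℝ) M ≤ (d * (1 + Real.log N)) ^ ms.length := by
  have hl := one_add_log_nonneg N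
  induction ms with
  | nil =>
    simp only [nestedCoeff, List.length_nil, pow_zero, Finset.sum_ite_eq']
    split_ifs <;> simp
  | cons m ms ih =>
    have ih' := ih fun i hi => hms i (List.mem_cons_of_mem _ hi)
    have hm : 1 ≤ m := hms m List.mem_cons_self
    calc ∑ M ∈ Finset.range N, nestedCoeff d (m :: ms) (1 : ℝ) M
        ≤ ∑ M ∈ Finset.range N, d / (M : ℝ) ^ 1 * (d * (1 + Real.log N)) ^ ms.length := by
          refine Finset.sum_le_sum fun M hM => nestedCoeff_cons_le hd hm ms (le_trans ?_ ih')
          exact Finset.sum_le_sum_of_subset_of_nonneg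
            (Finset.range_subset_range.2 (Finset.mem_range.1 hM).le)
            fun i _ _ => nestedCoeff_nonneg hd ms one_pos i
      _ = d * (∑ M ∈ Finset.range N, 1 / (M : ℝ)) * (d * (1 + Real.log N)) ^ ms.length := by
          rw [← Finset.sum_mul, Finset.mul_sum]
          simp [div_eq_mul_inv]
      _ ≤ d * (1 + Real.log N) * (d * (1 + Real.log N)) ^ ms.length := by
          gcongr
          exact sum_range_one_div_le N
      _ = _ := by rw [List.length_cons, pow_succ']

theorem summable_log_pow_div_sq (d r : ℕ) :
    Summable fun N : ℕ => d / (N : ℝ) ^ 2 * (d * (1 + Real.log N)) ^ r := by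
  -- Chosen so that `ε * r ≤ 1 / 2`: the logarithms cost at most `N ^ (1 / 2)`, leaving the summable
  -- `N ^ (-3 / 2)`.
  set ε : ℝ := 1 / (2 * (r + 1)) with hε
  have hε0 : 0 < ε := by positivity
  have hs : Summable fun N : ℕ => d * (d * (1 + 1 / ε)) ^ r * (1 / (N : ℝ) ^ (3 / 2 : ℝ)) :=
    (Real.summable_one_div_nat_rpow.2 (by norm_num)).mul_left _
  refine Summable.of_nonneg_of_le (fun N => ?_) (fun N => ?_) hs
  · have := one_add_log_nonneg N
    positivity
  · rcases Nat.eq_zero_or_pos N with rfl | hN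
    · simp
    have hN1 : (1 : ℝ) ≤ N := by exact_mod_cast hN
    have hN0 : (0 : ℝ) < N := by linarith
    have h1 : 1 + Real.log N ≤ (1 + 1 / ε) * (N : ℝ) ^ ε := by
      have := Real.log_le_rpow_div hN0.le hε0
      have h2 : 1 ≤ (N : ℝ) ^ ε := Real.one_le_rpow hN1 hε0.le
      have h3 : (1 + 1 / ε) * (N : ℝ) ^ ε = (N : ℝ) ^ ε + (N : ℝ) ^ ε / ε := by ring
      linarith
    have h2 : ((N : ℝ) ^ ε) ^ r ≤ (N : ℝ) ^ (1 / 2 : ℝ) := by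
      rw [← Real.rpow_natCast, ← Real.rpow_mul hN0.le]
      refine Real.rpow_le_rpow_of_exponent_le hN1 ?_
      rw [hε, div_mul_eq_mul_div, div_le_div_iff₀ (by positivity) (by norm_num)]
      linarith
    have h0 := one_add_log_nonneg N
    calc d / (N : ℝ) ^ 2 * (d * (1 + Real.log N)) ^ r
        ≤ d / (N : ℝ) ^ 2 * (d * ((1 + 1 / ε) * (N : ℝ) ^ ε)) ^ r := by gcongr
      _ = d * (d * (1 + 1 / ε)) ^ r * (((N : ℝ) ^ ε) ^ r / (N : ℝ) ^ 2) := by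
          rw [← mul_assoc, mul_pow _ ((N : ℝ) ^ ε)]
          ring
      _ ≤ d * (d * (1 + 1 / ε)) ^ r * ((N : ℝ) ^ (1 / 2 : ℝ) / (N : ℝ) ^ 2) := by gcongr
      _ = _ := by
          congr 1
          rw [← Real.rpow_natCast, ← Real.rpow_sub hN0, one_div ((N : ℝ) ^ (3 / 2 : ℝ)), ← Real.rpow_neg hN0.le]
          norm_num

/-- Compositions whose first entry exceeds `1`. -/
def IsAdmissible (ms : List ℕ) : Prop := ∃ m t, ms = m :: t ∧ 2 ≤ m ∧ ∀ i ∈ t, 0 < i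

theorem summable_nestedCoeff {d : ℕ} (hd : 0 < d) {ms : List ℕ} (hms : IsAdmissible ms) :
    Summable (nestedCoeff d ms (1 : ℝ)) := by
  obtain ⟨m, t, rfl, hm, ht⟩ := hms
  exact Summable.of_nonneg_of_le (nestedCoeff_nonneg hd _ one_pos)
    (fun N => nestedCoeff_cons_le hd hm t (sum_nestedCoeff_le hd ht N))
    (summable_log_pow_div_sq d t.length)

theorem summable_nestedCoeff_mul_pow {d : ℕ} (hd : 0 < d) {ms : List ℕ} (hms : ∀ i ∈ ms, 0 < i)
    {x : ℝ} (hx0 : 0 ≤ x) (hx1 : x < 1) :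
    Summable fun N => nestedCoeff d ms (1 : ℝ) N * x ^ N := by
  cases ms with
  | nil => exact summable_of_ne_finset_zero (s := {0}) fun N hN => by simp_all [nestedCoeff]
  | cons m t =>
    -- Without admissibility one factor `1 / N` is missing; it is bought from `x ^ N`, since `N * x
    -- ^ N` is bounded by the sum of its series.
    have hK : Summable fun N : ℕ => (N : ℝ) ^ 1 * x ^ N :=
      summable_pow_mul_geometric_of_norm_lt_one 1 (by rwa [Real.norm_of_nonneg hx0])
    have ht : ∀ i ∈ t, 0 < i := fun i hi => hms i (List.mem_cons_of_mem _ hi)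
    refine Summable.of_nonneg_of_le
      (fun N => mul_nonneg (nestedCoeff_nonneg hd _ one_pos N) (pow_nonneg hx0 N)) (fun N => ?_)
      ((summable_log_pow_div_sq d t.length).mul_left (∑' N : ℕ, (N : ℝ) ^ 1 * x ^ N))
    have h1 := nestedCoeff_cons_le hd (hms m List.mem_cons_self : 1 ≤ m) t
      (sum_nestedCoeff_le hd ht N)
    have h2 := hK.le_tsum N fun j _ => by positivity
    have h0 := one_add_log_nonneg N
    rcases Nat.eq_zero_or_pos N with rfl | hN
    · simp [nestedCoeff]
    have hN0 : (0 : ℝ) < N := by exact_mod_cast hN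
    calc _ ≤ d / (N : ℝ) ^ 1 * (d * (1 + Real.log N)) ^ t.length * x ^ N := by gcongr
      _ = (N : ℝ) ^ 1 * x ^ N * (d / (N : ℝ) ^ 2 * (d * (1 + Real.log N)) ^ t.length) := by
          field_simp
      _ ≤ _ := by gcongr

/-- For `q ≥ 2 ‖a₀ - 1‖` the triangle inequality gives the constant `1 / 2`; the finitely many
smaller `q` contribute a minimum. The same constant on a whole ball is what makes the bounds locally
uniform in `a`. -/
theorem exists_mul_le_norm {a₀ : ℂ} (h : ∀ q : ℕ, 1 ≤ q → (q : ℂ) + a₀ - 1 ≠ 0) :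
    ∃ δ > 0, ∀ a ∈ Metric.ball a₀ δ, ∀ q : ℕ, 1 ≤ q → δ * q ≤ ‖(q : ℂ) + a - 1‖ := by
  obtain ⟨Q, hQ⟩ := exists_nat_ge (2 * ‖a₀ - 1‖)
  have hfin : ∀ n : ℕ, ∃ δ > 0, ∀ q : ℕ, 1 ≤ q → q < n → δ * q ≤ ‖(q : ℂ) + a₀ - 1‖ := by
    intro n
    induction n with
    | zero => exact ⟨1, one_pos, fun q _ hq => absurd hq (Nat.not_lt_zero q)⟩
    | succ n ih =>
      obtain ⟨δ, hδ, hδ'⟩ := ih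
      rcases Nat.eq_zero_or_pos n with rfl | hn
      · exact ⟨δ, hδ, fun q h1 h2 => by omega⟩
      have hn0 : (0 : ℝ) < n := by exact_mod_cast hn
      have hpos := norm_pos_iff.2 (h n hn)
      refine ⟨min δ (‖(n : ℂ) + a₀ - 1‖ / n), lt_min hδ (by positivity), fun q h1 h2 => ?_⟩
      rcases Nat.lt_succ_iff_lt_or_eq.1 h2 with h2 | rfl
      · exact (mul_le_mul_of_nonneg_right (min_le_left _ _) (Nat.cast_nonneg _)).trans (hδ' q h1 h2)
      · exact (mul_le_mul_of_nonneg_right (min_le_right _ _) (Nat.cast_nonneg _)).trans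
          (div_mul_cancel₀ _ hn0.ne').le
  obtain ⟨δ, hδ, hδ'⟩ := hfin Q
  have key : ∀ q : ℕ, 1 ≤ q → min δ (1 / 2) * q ≤ ‖(q : ℂ) + a₀ - 1‖ := by
    intro q hq
    rcases lt_or_ge q Q with h1 | h1
    · exact (mul_le_mul_of_nonneg_right (min_le_left _ _) (Nat.cast_nonneg _)).trans (hδ' q hq h1)
    · refine (mul_le_mul_of_nonneg_right (min_le_right _ _) (Nat.cast_nonneg _)).trans ?_
      have h2 : ‖(q : ℂ)‖ - ‖a₀ - 1‖ ≤ ‖(q : ℂ) + a₀ - 1‖ := by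
        have := norm_sub_norm_le (q : ℂ) (-(a₀ - 1))
        rw [norm_neg] at this
        convert! this using 2
        ring
      rw [Complex.norm_natCast] at h2
      have h3 : (Q : ℝ) ≤ q := by exact_mod_cast h1
      linarith
  have hpos : 0 < min δ (1 / 2 : ℝ) := lt_min hδ (by norm_num)
  -- Half of the constant absorbs the displacement `‖a - a₀‖`, which is less than that half times
  -- `q` because `q ≥ 1`.
  refine ⟨min δ (1 / 2) / 2, by positivity, fun a ha q hq => ?_⟩
  rw [Metric.mem_ball, dist_eq_norm] at ha
  have h1 := key q hq
  have h2 : ‖(q : ℂ) + a₀ - 1‖ ≤ ‖(q : ℂ) + a - 1‖ + ‖a - a₀‖ := by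
    have := norm_sub_le ((q : ℂ) + a - 1) (a - a₀)
    convert! this using 2
    ring
  have h3 : (1 : ℝ) ≤ q := by exact_mod_cast hq
  nlinarith

/-! ### Derivatives in the Hurwitz parameter -/

theorem sum_antidiagonalTuple_succ {R : Type*} [AddCommMonoid R] (n k : ℕ)
    (f : (Fin (n + 1) → ℕ) → R) :
    ∑ j ∈ Finset.Nat.antidiagonalTuple (n + 1) k, f j =
      ∑ p ∈ Finset.HasAntidiagonal.antidiagonal k, ∑ j ∈ Finset.Nat.antidiagonalTuple n p.2,
        f (Fin.cons p.1 j) := by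
  rw [Finset.sum_sigma']
  refine Finset.sum_bij' (fun j _ => ⟨(j 0, ∑ i : Fin n, j i.succ), fun i => j i.succ⟩)
    (fun p _ => Fin.cons p.1.1 p.2) ?_ ?_ ?_ ?_ ?_
  · intro j hj
    rw [Finset.Nat.mem_antidiagonalTuple, Fin.sum_univ_succ] at hj
    simp [Finset.Nat.mem_antidiagonalTuple, hj]
  · rintro ⟨⟨p, q⟩, j⟩ hj
    simp only [Finset.mem_sigma, Finset.HasAntidiagonal.mem_antidiagonal, Finset.Nat.mem_antidiagonalTuple] at hj
    simp [Finset.Nat.mem_antidiagonalTuple, Fin.sum_univ_succ, hj]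
  · intro j hj
    ext i
    cases i using Fin.cases <;> simp
  · rintro ⟨⟨p, q⟩, j⟩ hj
    simp only [Finset.mem_sigma, Finset.HasAntidiagonal.mem_antidiagonal, Finset.Nat.mem_antidiagonalTuple] at hj
    simp [hj]
  · intro j hj
    congr 1
    ext i
    cases i using Fin.cases <;> simp

theorem length_addLists (ms : List ℕ) (j : Fin ms.length → ℕ) :
    (addLists ms (List.ofFn j)).length = ms.length := by
  simp [addLists]

theorem pos_of_mem_addLists {ms js : List ℕ} (h : ∀ i ∈ ms, 0 < i) :
    ∀ i ∈ addLists ms js, 0 < i := by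
  induction ms generalizing js with
  | nil => simp [addLists]
  | cons m ms ih =>
    cases js with
    | nil => simp [addLists]
    | cons j js =>
      have := ih (js := js) fun i hi => h i (List.mem_cons_of_mem _ hi)
      have hm := h m List.mem_cons_self
      simp only [addLists, List.zipWith_cons_cons, List.mem_cons] at *
      rintro i (rfl | hi)
      · omega
      · exact this i hi

theorem IsAdmissible.addLists {ms : List ℕ} (h : IsAdmissible ms) (j : Fin ms.length → ℕ) :
    IsAdmissible (addLists ms (List.ofFn j)) := by
  obtain ⟨m, t, rfl, hm, ht⟩ := h
  refine ⟨m + j 0, _root_.addLists t (List.ofFn fun i : Fin t.length => j i.succ), ?_, by omega,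
    pos_of_mem_addLists ht⟩
  simp [_root_.addLists, List.ofFn_succ]

theorem IsAdmissible.pos {ms : List ℕ} (h : IsAdmissible ms) : ∀ i ∈ ms, 0 < i := by
  obtain ⟨m, t, rfl, hm, ht⟩ := h
  simp only [List.mem_cons, forall_eq_or_imp]
  exact ⟨by omega, ht⟩

/-- Up to the factor `(-1) ^ k * k!`, the `k`-th derivative of `nestedCoeff d ms a N` in `a`. -/
noncomputable def nestedCoeffDeriv (d : ℕ) (ms : List ℕ) (k : ℕ) (a : ℂ) (N : ℕ) : ℂ :=
  ∑ j ∈ Finset.Nat.antidiagonalTuple ms.length k,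
    (multiBinom ms (List.ofFn j) : ℂ) * nestedCoeff d (addLists ms (List.ofFn j)) a N

/-- Separating the first entry of `j` from the others exhibits a Cauchy product, the form in which
the Leibniz rule can be applied by induction on depth. -/
theorem nestedCoeffDeriv_cons (d m : ℕ) (ms : List ℕ) (k : ℕ) (a : ℂ) (N : ℕ) :
    nestedCoeffDeriv d (m :: ms) k a N = ∑ p ∈ Finset.HasAntidiagonal.antidiagonal k,
      (((m + p.1 - 1).choose p.1 : ℂ) *
        (d / (stepExponent ℂ d (ms.length + 1) N + a - 1) ^ (m + p.1))) *
      ∑ M ∈ Finset.range N, nestedCoeffDeriv d ms p.2 a M := by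
  refine (sum_antidiagonalTuple_succ ms.length k _).trans (Finset.sum_congr rfl fun p _ => ?_)
  simp only [nestedCoeffDeriv]
  rw [Finset.sum_comm, Finset.mul_sum]
  refine Finset.sum_congr rfl fun j _ => ?_
  simp only [List.ofFn_succ, Fin.cons_zero, Fin.cons_succ, multiBinom, addLists,
    List.zipWith_cons_cons, List.prod_cons, nestedCoeff, List.length_zipWith, List.length_ofFn,
    min_self, Finset.mul_sum]
  refine Finset.sum_congr rfl fun M _ => ?_
  push_cast
  ring

theorem nestedCoeffDeriv_eq_zero (d : ℕ) (ms : List ℕ) (k : ℕ) (a : ℂ) {N : ℕ}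
    (h : N < ms.length) : nestedCoeffDeriv d ms k a N = 0 :=
  Finset.sum_eq_zero fun j _ => by
    rw [nestedCoeff_eq_zero _ _ _ (by rwa [length_addLists]), mul_zero]

/-- The Leibniz rule for normalised derivatives: if `uᵢ' = -(i + 1) uᵢ₊₁`, and likewise for `v`,
then their Cauchy product obeys the same rule, because the two indices add up to `k + 1`. -/
theorem sum_antidiagonal_deriv (u v : ℕ → ℂ) (k : ℕ) :
    ∑ p ∈ Finset.HasAntidiagonal.antidiagonal k,
        (-((p.1 : ℂ) + 1) * u (p.1 + 1) * v p.2 + u p.1 * (-((p.2 : ℂ) + 1) * v (p.2 + 1))) =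
      -((k : ℂ) + 1) * ∑ p ∈ Finset.HasAntidiagonal.antidiagonal (k + 1), u p.1 * v p.2 := by
  have h1 : ∑ p ∈ Finset.HasAntidiagonal.antidiagonal (k + 1), (p.1 : ℂ) * (u p.1 * v p.2) =
      ∑ p ∈ Finset.HasAntidiagonal.antidiagonal k, ((p.1 : ℂ) + 1) * (u (p.1 + 1) * v p.2) := by
    rw [Finset.Nat.sum_antidiagonal_succ]
    simp
  have h2 : ∑ p ∈ Finset.HasAntidiagonal.antidiagonal (k + 1), (p.2 : ℂ) * (u p.1 * v p.2) =
      ∑ p ∈ Finset.HasAntidiagonal.antidiagonal k, ((p.2 : ℂ) + 1) * (u p.1 * v (p.2 + 1)) := by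
    rw [Finset.Nat.sum_antidiagonal_succ']
    simp
  have h3 : ((k : ℂ) + 1) * ∑ p ∈ Finset.HasAntidiagonal.antidiagonal (k + 1), u p.1 * v p.2 =
      ∑ p ∈ Finset.HasAntidiagonal.antidiagonal (k + 1), (p.1 : ℂ) * (u p.1 * v p.2) +
      ∑ p ∈ Finset.HasAntidiagonal.antidiagonal (k + 1), (p.2 : ℂ) * (u p.1 * v p.2) := by
    rw [← Finset.sum_add_distrib, Finset.mul_sum]
    refine Finset.sum_congr rfl fun p hp => ?_
    have : ((k : ℂ) + 1) = p.1 + p.2 := by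
      rw [Finset.HasAntidiagonal.mem_antidiagonal] at hp
      exact_mod_cast hp.symm
    rw [this]
    ring
  rw [neg_mul, h3, h1, h2, ← Finset.sum_add_distrib, ← Finset.sum_neg_distrib]
  exact Finset.sum_congr rfl fun p _ => by ring

theorem hasDerivAt_choose_mul_div_pow (d : ℂ) {m : ℕ} (hm : 0 < m) (i : ℕ) (c a : ℂ)
    (h : c + a - 1 ≠ 0) :
    HasDerivAt (fun a => ((m + i - 1).choose i : ℂ) * (d / (c + a - 1) ^ (m + i)))
      (-((i : ℂ) + 1) * (((m + (i + 1) - 1).choose (i + 1) : ℂ) *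
        (d / (c + a - 1) ^ (m + (i + 1))))) a := by
  obtain ⟨m, rfl⟩ := Nat.exists_eq_add_of_le' hm
  have h1 : HasDerivAt (fun a : ℂ => c + a - 1) 1 a := ((hasDerivAt_id a).const_add c).sub_const 1
  have h2 := (((h1.pow (m + 1 + i)).inv (pow_ne_zero _ h)).const_mul d).const_mul
    ((m + 1 + i - 1).choose i : ℂ)
  simp only [div_eq_mul_inv]
  refine h2.congr_deriv ?_
  have e1 : m + 1 + i - 1 = m + i := by omega
  have e2 : m + 1 + (i + 1) - 1 = m + i + 1 := by omega
  have e3 : m + 1 + (i + 1) = m + i + 2 := by omega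
  have e4 : m + 1 + i = m + i + 1 := by omega
  -- With `m` shifted down by one, this absorption identity is why the coefficients of `B` arise
  -- from repeated differentiation of a power.
  have hc : ((m : ℂ) + i + 1) * ((m + i).choose i : ℂ) =
      ((m + i + 1).choose (i + 1) : ℂ) * (i + 1) := by
    exact_mod_cast Nat.add_one_mul_choose_eq (m + i) i
  rw [e1, e2, e3, e4]
  simp only [Pi.pow_apply]
  push_cast
  field_simp
  linear_combination (-d * (c + a - 1) ^ (2 * (m + i + 1))) * hc

theorem hasDerivAt_nestedCoeffDeriv {d : ℕ} (hd : 0 < d) {ms : List ℕ} (hms : ∀ i ∈ ms, 0 < i)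
    (k : ℕ) {a : ℂ} (ha : ∀ q : ℕ, 1 ≤ q → (q : ℂ) + a - 1 ≠ 0) (N : ℕ) :
    HasDerivAt (fun a => nestedCoeffDeriv d ms k a N)
      (-((k : ℂ) + 1) * nestedCoeffDeriv d ms (k + 1) a N) a := by
  induction ms generalizing k N with
  | nil =>
    have h : nestedCoeffDeriv d [] (k + 1) a N = 0 := by
      simp [nestedCoeffDeriv]
    rw [h, mul_zero]
    have : ∀ b, nestedCoeffDeriv d [] k b N = nestedCoeffDeriv d [] k a N := fun b => by
      simp [nestedCoeffDeriv, addLists, nestedCoeff]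
    simp_rw [this]
    exact hasDerivAt_const _ _
  | cons m ms ih =>
    by_cases hN : N < (m :: ms).length
    · simp_rw [nestedCoeffDeriv_eq_zero _ _ _ _ hN, mul_zero]
      exact hasDerivAt_const _ _
    · rw [List.length_cons] at hN
      have hne : stepExponent ℂ d (ms.length + 1) N + a - 1 ≠ 0 := by
        rw [stepExponent_eq_natCast hd (not_lt.1 hN)]
        exact ha _ ((by omega : 1 ≤ N).trans (Nat.le_add_right _ _))
      simp_rw [nestedCoeffDeriv_cons]
      have h2 : ∀ l, HasDerivAt (fun a => ∑ M ∈ Finset.range N, nestedCoeffDeriv d ms l a M)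
          (-((l : ℂ) + 1) * ∑ M ∈ Finset.range N, nestedCoeffDeriv d ms (l + 1) a M) a := fun l => by
        rw [Finset.mul_sum]
        exact HasDerivAt.fun_sum fun M _ => ih (fun i hi => hms i (List.mem_cons_of_mem _ hi)) l M
      have h3 := HasDerivAt.fun_sum (u := Finset.HasAntidiagonal.antidiagonal k) fun p _ =>
        (hasDerivAt_choose_mul_div_pow d (hms m List.mem_cons_self) p.1 _ a hne).fun_mul (h2 p.2)
      refine h3.congr_deriv ?_
      exact sum_antidiagonal_deriv
        (fun i => ((m + i - 1).choose i : ℂ) *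
          (d / (stepExponent ℂ d (ms.length + 1) N + a - 1) ^ (m + i)))
        (fun l => ∑ M ∈ Finset.range N, nestedCoeffDeriv d ms l a M) k

theorem summable_nestedCoeff_complex {d : ℕ} (hd : 0 < d) {ms : List ℕ} (hms : IsAdmissible ms)
    {a : ℂ} (ha : ∀ q : ℕ, 1 ≤ q → (q : ℂ) + a - 1 ≠ 0) : Summable (nestedCoeff d ms a) := by
  obtain ⟨δ, hδ, h⟩ := exists_mul_le_norm ha
  exact Summable.of_norm_bounded ((summable_nestedCoeff hd hms).mul_left _)
    (norm_nestedCoeff_le hd ms hδ (h a (Metric.mem_ball_self hδ)))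

/-- Up to the factor `(-1) ^ k * k!`, the `k`-th derivative of `∑' N, nestedCoeff d ms a N`. -/
noncomputable def nestedSumDeriv (d : ℕ) (ms : List ℕ) (k : ℕ) (a : ℂ) : ℂ :=
  ∑' N, nestedCoeffDeriv d ms k a N

/-- By the Weierstrass theorem: the comparison with `a = 1` gives a summable majorant on a ball, so
the series is holomorphic and differentiates termwise. -/
theorem hasDerivAt_nestedSumDeriv {d : ℕ} (hd : 0 < d) {ms : List ℕ} (hms : IsAdmissible ms)
    (k : ℕ) {a : ℂ} (ha : ∀ q : ℕ, 1 ≤ q → (q : ℂ) + a - 1 ≠ 0) :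
    HasDerivAt (nestedSumDeriv d ms k) (-((k : ℂ) + 1) * nestedSumDeriv d ms (k + 1) a) a := by
  obtain ⟨δ, hδ, h⟩ := exists_mul_le_norm ha
  have hne : ∀ b ∈ Metric.ball a δ, ∀ q : ℕ, 1 ≤ q → (q : ℂ) + b - 1 ≠ 0 := by
    intro b hb q hq h0
    have h1 := h b hb q hq
    have h2 : (1 : ℝ) ≤ q := by exact_mod_cast hq
    rw [h0, norm_zero] at h1
    nlinarith
  set u : ℕ → ℝ := fun N => ∑ j ∈ Finset.Nat.antidiagonalTuple ms.length k,
    (multiBinom ms (List.ofFn j) : ℝ) * ((1 / δ) ^ (addLists ms (List.ofFn j)).sum *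
      nestedCoeff d (addLists ms (List.ofFn j)) (1 : ℝ) N)
  have hu : Summable u := summable_sum fun j _ =>
    ((summable_nestedCoeff hd (hms.addLists j)).mul_left _).mul_left _
  have hle : ∀ N, ∀ b ∈ Metric.ball a δ, ‖nestedCoeffDeriv d ms k b N‖ ≤ u N := by
    intro N b hb
    refine norm_sum_le_of_le _ fun j _ => ?_
    rw [norm_mul, Complex.norm_natCast]
    exact mul_le_mul_of_nonneg_left (norm_nestedCoeff_le hd _ hδ (h b hb) N) (Nat.cast_nonneg _)
  have hdiff : ∀ N, DifferentiableOn ℂ (fun b => nestedCoeffDeriv d ms k b N) (Metric.ball a δ) :=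
    fun N b hb => (hasDerivAt_nestedCoeffDeriv hd hms.pos k (hne b hb) N).differentiableAt
      |>.differentiableWithinAt
  have hmem := Metric.mem_ball_self (x := a) hδ
  have h1 := Complex.hasSum_deriv_of_summable_norm hu hdiff Metric.isOpen_ball hle hmem
  have h2 := ((Complex.differentiableOn_tsum_of_summable_norm hu hdiff Metric.isOpen_ball hle)
    a hmem).differentiableAt (Metric.isOpen_ball.mem_nhds hmem)
  refine h2.hasDerivAt.congr_deriv ?_
  rw [← h1.tsum_eq, nestedSumDeriv, ← tsum_mul_left]
  exact tsum_congr fun N => (hasDerivAt_nestedCoeffDeriv hd hms.pos k ha N).deriv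

theorem nestedSumDeriv_eq {d : ℕ} (hd : 0 < d) {ms : List ℕ} (hms : IsAdmissible ms)
    (k : ℕ) {a : ℂ} (ha : ∀ q : ℕ, 1 ≤ q → (q : ℂ) + a - 1 ≠ 0) :
    nestedSumDeriv d ms k a = ∑ j ∈ Finset.Nat.antidiagonalTuple ms.length k,
      (multiBinom ms (List.ofFn j) : ℂ) * ∑' N, nestedCoeff d (addLists ms (List.ofFn j)) a N := by
  simp only [nestedSumDeriv, nestedCoeffDeriv]
  rw [Summable.tsum_finsetSum fun j _ =>
    (summable_nestedCoeff_complex hd (hms.addLists j) ha).mul_left _]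
  exact Finset.sum_congr rfl fun j _ => tsum_mul_left

theorem nestedSumDeriv_zero {d : ℕ} (ms : List ℕ) (a : ℂ) :
    nestedSumDeriv d ms 0 a = ∑' N, nestedCoeff d ms a N := by
  refine tsum_congr fun N => ?_
  have h1 : ∀ ms : List ℕ, multiBinom ms (List.ofFn (0 : Fin ms.length → ℕ)) = 1 ∧
      addLists ms (List.ofFn (0 : Fin ms.length → ℕ)) = ms := by
    intro ms
    induction ms with
    | nil => simp [multiBinom, addLists]
    | cons m ms ih =>
      simp only [multiBinom, addLists] at ih
      refine ⟨?_, ?_⟩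
      · simp only [multiBinom, List.length_cons, List.ofFn_succ, List.zipWith_cons_cons,
          List.prod_cons, Pi.zero_apply, Nat.choose_zero_right, one_mul]
        exact ih.1
      · simp only [addLists, List.length_cons, List.ofFn_succ, List.zipWith_cons_cons,
          Pi.zero_apply, add_zero]
        exact congrArg _ ih.2
  rw [nestedCoeffDeriv, Finset.Nat.antidiagonalTuple_zero_right, Finset.sum_singleton, (h1 ms).1,
    (h1 ms).2, Nat.cast_one, one_mul]

/-! ### The values `ζ(m; a)` as series over the outermost index -/

theorem tendsto_hurwitzHarmonicSum {ms : List ℕ} (hms : IsAdmissible ms) {a : ℂ}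
    (ha : ∀ q : ℕ, 1 ≤ q → (q : ℂ) + a - 1 ≠ 0) :
    Tendsto (hurwitzHarmonicSum ms a) atTop (𝓝 (∑' N, nestedCoeff 1 ms a N)) := by
  rw [funext (hurwitzHarmonicSum_eq ms a)]
  exact ((summable_nestedCoeff_complex one_pos hms ha).hasSum.tendsto_sum_nat).comp
    (tendsto_add_atTop_nat 1)

theorem hurwitzMZV_eq {ms : List ℕ} (hms : IsAdmissible ms) {a : ℂ}
    (ha : ∀ q : ℕ, 1 ≤ q → (q : ℂ) + a - 1 ≠ 0) :
    hurwitzMZV ms a = ∑' N, nestedCoeff 1 ms a N :=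
  (tendsto_hurwitzHarmonicSum hms ha).limUnder_eq

/-! ### Words and Hoffman duality -/

/-- The word in two letters attached to a composition: `m` becomes `m - 1` letters `false` and
a letter `true`. -/
def indexWord (ms : List ℕ) : List Bool := ms.flatMap fun m => List.replicate (m - 1) false ++ [true]

theorem indexWord_cons (m : ℕ) (ms : List ℕ) :
    indexWord (m :: ms) = List.replicate (m - 1) false ++ true :: indexWord ms := by
  simp [indexWord]

theorem indexWord_incHead {ms : List ℕ} (hne : ms ≠ []) (hpos : ∀ i ∈ ms, 0 < i) :
    indexWord (incHead ms) = false :: indexWord ms := by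
  cases ms with
  | nil => exact absurd rfl hne
  | cons m ms =>
    obtain ⟨m, rfl⟩ := Nat.exists_eq_add_of_le' (hpos m List.mem_cons_self)
    simp [incHead, indexWord_cons, List.replicate_succ]

/-- A plus sign lengthens the current entry, hence is a letter `false`; a comma closes it, hence is
a letter `true`. The last entry is closed by the extra `true`. -/
theorem ofSeparators_spec (s : List Bool) :
    ofSeparators s ≠ [] ∧ (∀ i ∈ ofSeparators s, 0 < i) ∧
      indexWord (ofSeparators s) = s.map not ++ [true] := by
  induction s with
  | nil => simp [ofSeparators, indexWord]
  | cons b s ih =>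
    obtain ⟨h1, h2, h3⟩ := ih
    cases b with
    | false => simpa [ofSeparators, indexWord_cons, h3] using h2
    | true =>
      refine ⟨?_, ?_, ?_⟩
      · obtain ⟨m, t, h⟩ := List.exists_cons_of_ne_nil h1
        simp [ofSeparators, h, incHead]
      · obtain ⟨m, t, h⟩ := List.exists_cons_of_ne_nil h1
        rw [h] at h2
        simp only [ofSeparators, h, incHead, List.mem_cons, forall_eq_or_imp] at h2 ⊢
        exact ⟨Nat.succ_pos _, h2.2⟩
      · rw [ofSeparators, indexWord_incHead h1 h2, h3]
        simp

theorem separators_append_singleton {ks : List ℕ} (hne : ks ≠ []) (k : ℕ) :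
    separators (ks ++ [k]) = separators ks ++ false :: List.replicate (k - 1) true := by
  induction ks with
  | nil => exact absurd rfl hne
  | cons l ks ih =>
    cases ks with
    | nil => simp [separators, List.intercalate]
    | cons l' ks =>
      have := ih (by simp)
      simp only [separators, List.map_append, List.map_cons, List.cons_append,
        List.intercalate_cons_cons] at this ⊢
      rw [this]
      simp

/-- The final `true` of the word, reversed and negated, becomes a leading `false`. This is exactly
the letter that `incHead` adds to the dual. -/
theorem map_not_reverse_indexWord {ks : List ℕ} (hne : ks ≠ []) :
    (indexWord ks).reverse.map not = false :: separators ks.reverse := by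
  induction ks with
  | nil => exact absurd rfl hne
  | cons k ks ih =>
    rcases eq_or_ne ks [] with rfl | h
    · simp [indexWord, separators, List.intercalate]
    · rw [List.reverse_cons, separators_append_singleton (by simpa using h), ← List.cons_append,
        ← ih h, indexWord_cons]
      simp

theorem hoffmanDual_spec {ks : List ℕ} (hne : ks ≠ []) :
    hoffmanDual ks ≠ [] ∧ (∀ i ∈ hoffmanDual ks, 0 < i) ∧
      indexWord (hoffmanDual ks) = separators ks ++ [true] := by
  cases ks with
  | nil => exact absurd rfl hne
  | cons k ks => simpa [hoffmanDual, Function.comp_def] using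
      ofSeparators_spec ((separators (k :: ks)).map not)

theorem indexWord_incHead_hoffmanDual {ks : List ℕ} (hne : ks ≠ []) :
    indexWord (incHead (hoffmanDual ks.reverse)) = (indexWord ks).reverse.map not ++ [true] := by
  obtain ⟨h1, h2, h3⟩ := hoffmanDual_spec (ks := ks.reverse) (by simpa using hne)
  rw [indexWord_incHead h1 h2, h3, map_not_reverse_indexWord hne, List.cons_append]

theorem isAdmissible_incHead_hoffmanDual {ks : List ℕ} (hne : ks ≠ []) :
    IsAdmissible (incHead (hoffmanDual ks.reverse)) := by
  obtain ⟨h1, h2, -⟩ := hoffmanDual_spec (ks := ks.reverse) (by simpa using hne)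
  obtain ⟨m, t, h⟩ := List.exists_cons_of_ne_nil h1
  rw [h] at h2 ⊢
  have := h2 m List.mem_cons_self
  exact ⟨m + 1, t, rfl, by omega, fun i hi => h2 i (List.mem_cons_of_mem _ hi)⟩

theorem count_true_indexWord (ms : List ℕ) : (indexWord ms).count true = ms.length := by
  induction ms with
  | nil => rfl
  | cons m ms ih => simp [indexWord_cons, ih, List.count_replicate]

theorem length_indexWord {ms : List ℕ} (hpos : ∀ i ∈ ms, 0 < i) :
    (indexWord ms).length = ms.sum := by
  induction ms with
  | nil => rfl
  | cons m ms ih =>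
    have h1 := hpos m List.mem_cons_self
    have h2 := ih fun i hi => hpos i (List.mem_cons_of_mem _ hi)
    simp only [indexWord_cons, List.length_append, List.length_replicate, List.length_cons, h2,
      List.sum_cons]
    omega

theorem length_incHead_hoffmanDual {ks : List ℕ} (hne : ks ≠ []) (hpos : ∀ i ∈ ks, 0 < i) :
    (incHead (hoffmanDual ks.reverse)).length = ks.sum + 1 - ks.length := by
  -- Letters `true` count entries: the word has `ks.length` of them, its negation the remaining
  -- `ks.sum - ks.length`, and the appended letter adds one.
  have h1 : ((indexWord ks).map not).count true + (indexWord ks).count true =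
      (indexWord ks).length := by
    induction indexWord ks with
    | nil => rfl
    | cons b w ih => cases b <;> simp at ih ⊢ <;> omega
  rw [count_true_indexWord, length_indexWord hpos] at h1
  rw [← count_true_indexWord, indexWord_incHead_hoffmanDual hne, List.count_append,
    ← List.map_reverse.symm, List.count_reverse, List.count_singleton_self]
  omega

/-! ### Iterated integrals and the dual involutions -/

/-- The densities of the two differential forms `dx / x` and `d dx / (1 - x ^ d)`. -/
noncomputable def letterWeight (d : ℕ) : Bool → ℝ → ℝ
  | false, x => 1 / x
  | true, x => d / (1 - x ^ d)

/-- The measure on `(0, 1)` with density `letterWeight d b`. -/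
noncomputable def letterMeasure (d : ℕ) (b : Bool) : Measure ℝ :=
  (volume.restrict (Set.Ioo 0 1)).withDensity fun x => ENNReal.ofReal (letterWeight d b x)

/-- Iterated integrals from `0` to `x` along a word, the innermost integrand being `f`. -/
noncomputable def iteratedIntegral (d : ℕ) (f : ℝ → ENNReal) : List Bool → ℝ → ENNReal
  | [] => f
  | b :: w => fun x => ∫⁻ s in Set.Iio x, iteratedIntegral d f w s ∂letterMeasure d b

theorem measurable_letterWeight (d : ℕ) (b : Bool) : Measurable (letterWeight d b) := by
  cases b
  · exact measurable_const.div measurable_id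
  · exact measurable_const.div (measurable_const.sub (measurable_id.pow_const d))

instance (d : ℕ) (b : Bool) : SFinite (letterMeasure d b) := by
  unfold letterMeasure
  infer_instance

theorem letterWeight_nonneg (d : ℕ) (b : Bool) {x : ℝ} (hx : x ∈ Set.Ioo (0 : ℝ) 1) :
    0 ≤ letterWeight d b x := by
  cases b
  · exact div_nonneg zero_le_one hx.1.le
  · exact div_nonneg (Nat.cast_nonneg _) (sub_nonneg.2 (pow_le_one₀ hx.1.le hx.2.le))

theorem lintegral_letterMeasure (d : ℕ) (b : Bool) (g : ℝ → ENNReal) :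
    ∫⁻ x, g x ∂letterMeasure d b =
      ∫⁻ x in Set.Ioo 0 1, ENNReal.ofReal (letterWeight d b x) * g x := by
  rw [letterMeasure, lintegral_withDensity_eq_lintegral_mul_non_measurable _
    (measurable_letterWeight d b).ennreal_ofReal (ae_of_all _ fun x => ENNReal.ofReal_lt_top)]
  rfl

theorem setLIntegral_letterMeasure (d : ℕ) (b : Bool) (g : ℝ → ENNReal) {x : ℝ} (hx : x ≤ 1) :
    ∫⁻ s in Set.Iio x, g s ∂letterMeasure d b =
      ∫⁻ s in Set.Ioo 0 x, ENNReal.ofReal (letterWeight d b s) * g s := by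
  have h : Set.Iio x ∩ Set.Ioo 0 1 = Set.Ioo 0 x := by
    ext s
    simp only [Set.mem_inter_iff, Set.mem_Iio, Set.mem_Ioo]
    exact ⟨fun h => ⟨h.2.1, h.1⟩, fun h => ⟨h.2, h.1, h.2.trans_le hx⟩⟩
  rw [letterMeasure, restrict_withDensity measurableSet_Iio,
    Measure.restrict_restrict measurableSet_Iio, h,
    lintegral_withDensity_eq_lintegral_mul_non_measurable _
      (measurable_letterWeight d b).ennreal_ofReal (ae_of_all _ fun x => ENNReal.ofReal_lt_top)]
  rfl

theorem ae_mem_Ioo_letterMeasure (d : ℕ) (b : Bool) :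
    ∀ᵐ x ∂letterMeasure d b, x ∈ Set.Ioo (0 : ℝ) 1 :=
  (withDensity_absolutelyContinuous _ _).ae_le (ae_restrict_mem measurableSet_Ioo)

theorem measurable_iteratedIntegral (d : ℕ) {f : ℝ → ENNReal} (hf : Measurable f)
    (w : List Bool) : Measurable (iteratedIntegral d f w) := by
  cases w with
  | nil => exact hf
  | cons b w =>
    refine Monotone.measurable fun x y hxy => ?_
    exact lintegral_mono_set (Set.Iio_subset_Iio hxy)

/-- An involution of `(0, 1)` that exchanges `dx / x` and `d dx / (1 - x ^ d)` up to sign. -/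
structure IsDualInvolution (d : ℕ) (τ : ℝ → ℝ) : Prop where
  measurable : Measurable τ
  mapsTo : ∀ x ∈ Set.Ioo (0 : ℝ) 1, τ x ∈ Set.Ioo (0 : ℝ) 1
  involutive : ∀ x ∈ Set.Ioo (0 : ℝ) 1, τ (τ x) = x
  strictAntiOn : StrictAntiOn τ (Set.Ioo 0 1)
  hasDerivAt : ∀ x ∈ Set.Ioo (0 : ℝ) 1, HasDerivAt τ (-(τ x * letterWeight d true x)) x

theorem isDualInvolution_one_sub : IsDualInvolution 1 fun x => 1 - x where
  measurable := by fun_prop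
  mapsTo x hx := ⟨by linarith [hx.2], by linarith [hx.1]⟩
  involutive x _ := by ring
  strictAntiOn x _ y _ h := by
    change 1 - y < 1 - x
    linarith
  hasDerivAt x hx := by
    refine ((hasDerivAt_id x).const_sub 1).congr_deriv ?_
    have : 1 - x ≠ 0 := by linarith [hx.2]
    simp only [letterWeight, Nat.cast_one, pow_one]
    field_simp

theorem isDualInvolution_cayley : IsDualInvolution 2 fun x => (1 - x) / (1 + x) where
  measurable := by fun_prop
  mapsTo x hx := by
    have h0 := hx.1
    have h1 := hx.2
    constructor
    · apply div_pos <;> linarith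
    · rw [div_lt_one (by linarith)]
      linarith
  involutive x hx := by
    have h0 := hx.1
    have h : 1 + x ≠ 0 := by linarith
    field_simp
    ring
  strictAntiOn x hx y hy h := by
    have h0 := hx.1
    have h1 := hy.1
    change (1 - y) / (1 + y) < (1 - x) / (1 + x)
    rw [div_lt_div_iff₀ (by linarith) (by linarith)]
    linarith
  hasDerivAt x hx := by
    have h0 := hx.1
    have h1 := hx.2
    have h : 1 + x ≠ 0 := by linarith
    have h' : 1 - x ≠ 0 := by linarith
    refine (((hasDerivAt_id x).const_sub 1).fun_div ((hasDerivAt_id x).const_add 1) h).congr_deriv ?_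
    have h2 : 1 - x ^ 2 = (1 - x) * (1 + x) := by ring
    simp only [letterWeight, h2, id, Nat.cast_ofNat]
    field_simp
    ring

namespace IsDualInvolution

variable {d : ℕ} {τ : ℝ → ℝ}

/-- Change of variables: `|τ'| / τ` is the density of the letter `true`, by the differential
equation for `τ`. -/
theorem lintegral_comp_true (h : IsDualInvolution d τ) (g : ℝ → ENNReal) :
    ∫⁻ x, g (τ x) ∂letterMeasure d true = ∫⁻ x, g x ∂letterMeasure d false := by
  have himg : τ '' Set.Ioo 0 1 = Set.Ioo 0 1 := by
    ext y
    exact ⟨fun ⟨x, hx, e⟩ => e ▸ h.mapsTo x hx, fun hy => ⟨τ y, h.mapsTo y hy, h.involutive y hy⟩⟩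
  rw [lintegral_letterMeasure, lintegral_letterMeasure]
  conv_rhs => rw [← himg]
  rw [lintegral_image_eq_lintegral_abs_deriv_mul measurableSet_Ioo
    (fun x hx => (h.hasDerivAt x hx).hasDerivWithinAt) h.strictAntiOn.injOn]
  refine setLIntegral_congr_fun measurableSet_Ioo fun x hx => ?_
  have h1 := (h.mapsTo x hx).1
  have h2 := letterWeight_nonneg d true hx
  change _ = _ * (_ * _)
  rw [← mul_assoc, ← ENNReal.ofReal_mul (abs_nonneg _), abs_neg, abs_of_nonneg (by positivity)]
  congr 2
  simp only [letterWeight]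
  field_simp

theorem lintegral_comp (h : IsDualInvolution d τ) (b : Bool) (g : ℝ → ENNReal) :
    ∫⁻ x, g (τ x) ∂letterMeasure d b = ∫⁻ x, g x ∂letterMeasure d (!b) := by
  cases b with
  | true => exact h.lintegral_comp_true g
  | false =>
    refine (h.lintegral_comp_true fun x => g (τ x)).symm.trans (lintegral_congr_ae ?_)
    filter_upwards [ae_mem_Ioo_letterMeasure d true] with x hx
    rw [h.involutive x hx]

/-- Moves one letter from the left iterated integral to the right one. Substituting `τ s` for `s`
flips the letter and, as `τ` decreases, turns the region `s < τ t` into `t < s`; Tonelli then makes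
`t` the inner variable. -/
theorem lintegral_transport (h : IsDualInvolution d τ) (b c : Bool) {L P : ℝ → ENNReal}
    (hL : Measurable L) (hP : Measurable P) :
    ∫⁻ t, (∫⁻ s in Set.Iio (τ t), L s ∂letterMeasure d b) * P t ∂letterMeasure d c =
      ∫⁻ t, L (τ t) * ∫⁻ s in Set.Iio t, P s ∂letterMeasure d c ∂letterMeasure d (!b) := by
  have e1 : ∀ᵐ t ∂letterMeasure d c,
      (∫⁻ s in Set.Iio (τ t), L s ∂letterMeasure d b) * P t =
        ∫⁻ s, (Set.Ioi t).indicator (fun s => L (τ s)) s * P t ∂letterMeasure d (!b) := by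
    filter_upwards [ae_mem_Ioo_letterMeasure d c] with t ht
    have hLτ : Measurable fun s => L (τ s) := hL.comp h.measurable
    rw [lintegral_mul_const _ (hLτ.indicator measurableSet_Ioi),
      ← lintegral_indicator measurableSet_Iio]
    congr 1
    have := h.lintegral_comp (!b) ((Set.Iio (τ t)).indicator L)
    rw [Bool.not_not] at this
    rw [← this]
    refine lintegral_congr_ae ?_
    filter_upwards [ae_mem_Ioo_letterMeasure d (!b)] with s hs
    have hiff : τ s ∈ Set.Iio (τ t) ↔ s ∈ Set.Ioi t := h.strictAntiOn.lt_iff_gt hs ht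
    by_cases hst : s ∈ Set.Ioi t
    · rw [Set.indicator_of_mem hst, Set.indicator_of_mem (hiff.2 hst)]
    · rw [Set.indicator_of_notMem hst, Set.indicator_of_notMem (hst ∘ hiff.1)]
  rw [lintegral_congr_ae e1, lintegral_lintegral_swap]
  · refine lintegral_congr fun s => ?_
    rw [← lintegral_indicator measurableSet_Iio,
      ← lintegral_const_mul _ (hP.indicator measurableSet_Iio)]
    refine lintegral_congr fun t => ?_
    by_cases hst : t < s
    · rw [Set.indicator_of_mem (show s ∈ Set.Ioi t from hst),
        Set.indicator_of_mem (show t ∈ Set.Iio s from hst)]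
    · rw [Set.indicator_of_notMem (show s ∉ Set.Ioi t from hst),
        Set.indicator_of_notMem (show t ∉ Set.Iio s from hst), zero_mul, mul_zero]
  · have hm : MeasurableSet {p : ℝ × ℝ | p.1 < p.2} := measurableSet_lt measurable_fst measurable_snd
    have : Measurable fun p : ℝ × ℝ =>
        {p : ℝ × ℝ | p.1 < p.2}.indicator (fun p => L (τ p.2)) p * P p.1 :=
      (((hL.comp h.measurable).comp measurable_snd).indicator hm).mul (hP.comp measurable_fst)
    exact this.aemeasurable

theorem lintegral_iteratedIntegral_comp (h : IsDualInvolution d τ) {f g : ℝ → ENNReal}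
    (hf : Measurable f) (hg : Measurable g) (w : List Bool) (c : Bool) (v : List Bool) :
    ∫⁻ t, iteratedIntegral d g w (τ t) * iteratedIntegral d f v t ∂letterMeasure d c =
      ∫⁻ t, g (τ t) * iteratedIntegral d f ((w.reverse.map not ++ c :: v).tail) t
        ∂letterMeasure d ((w.reverse.map not ++ c :: v).headI) := by
  induction w generalizing c v with
  | nil => rfl
  | cons b w ih =>
    rw [show ((b :: w).reverse.map not ++ c :: v) = w.reverse.map not ++ (!b) :: c :: v by simp,
      ← ih (!b) (c :: v)]
    exact h.lintegral_transport b c (measurable_iteratedIntegral d hg w)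
      (measurable_iteratedIntegral d hf v)

theorem lintegral_iteratedIntegral_one_comp (h : IsDualInvolution d τ) {f : ℝ → ENNReal}
    (hf : Measurable f) (w : List Bool) (c : Bool) :
    ∫⁻ t, iteratedIntegral d (fun _ => 1) w (τ t) * f t ∂letterMeasure d c =
      iteratedIntegral d f (w.reverse.map not ++ [c]) 1 := by
  refine (h.lintegral_iteratedIntegral_comp hf measurable_const w c []).trans ?_
  obtain ⟨b, u, hu⟩ := List.exists_cons_of_ne_nil (l := w.reverse.map not ++ [c]) (by simp)
  simp only [hu, one_mul, List.tail_cons, List.headI_cons, iteratedIntegral]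
  rw [setLIntegral_letterMeasure d b _ le_rfl, lintegral_letterMeasure]

end IsDualInvolution

/-! ### Series expansion of iterated integrals -/

theorem tsum_tsum_add_one_add (F : ℕ → ℕ → ENNReal) :
    ∑' M, ∑' e, F M (M + 1 + e) = ∑' N, ∑ M ∈ Finset.range N, F M N := by
  have h1 : ∀ M, ∑' e, F M (M + 1 + e) = ∑' N, if M < N then F M N else 0 := by
    intro M
    have hinj : Function.Injective fun e => M + 1 + e := fun e e' h => by simpa using h
    rw [← hinj.tsum_eq (f := fun N => if M < N then F M N else 0)]
    · exact tsum_congr fun e => by rw [if_pos (by omega)]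
    · intro N hN
      rw [Function.mem_support, ne_eq, ite_eq_right_iff, Classical.not_imp] at hN
      exact ⟨N - (M + 1), by have := hN.1; change M + 1 + (N - (M + 1)) = N; omega⟩
  simp_rw [h1]
  rw [ENNReal.tsum_comm]
  refine tsum_congr fun N => ?_
  rw [tsum_eq_sum (s := Finset.range N)]
  · exact Finset.sum_congr rfl fun M hM => if_pos (Finset.mem_range.1 hM)
  · exact fun M hM => if_neg fun h => hM (Finset.mem_range.2 h)

/-- The alternative `c = 0` covers the indices below the depth, where the exponent may fail to be
positive but the coefficient vanishes. -/
theorem lintegral_Ioo_mul_rpow {c p x : ℝ} (hc : 0 ≤ c) (hp : c = 0 ∨ 0 < p) (hx : 0 ≤ x) :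
    ∫⁻ s in Set.Ioo 0 x, ENNReal.ofReal (c * s ^ (p - 1)) = ENNReal.ofReal (c / p * x ^ p) := by
  rcases hp with rfl | hp
  · simp
  have hi : IntegrableOn (fun s : ℝ => s ^ (p - 1)) (Set.Ioc 0 x) :=
    (intervalIntegral.intervalIntegrable_rpow' (a := 0) (b := x) (by linarith)).1
  simp_rw [ENNReal.ofReal_mul hc]
  rw [lintegral_const_mul _ (by fun_prop), restrict_Ioo_eq_restrict_Ioc,
    ← ofReal_integral_eq_lintegral_ofReal hi, ← intervalIntegral.integral_of_le hx,
    integral_rpow (Or.inl (by linarith)), sub_add_cancel, Real.zero_rpow hp.ne', sub_zero,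
    ← ENNReal.ofReal_mul hc, mul_div_assoc', div_mul_eq_mul_div]
  filter_upwards [ae_restrict_mem measurableSet_Ioc] with s hs
  exact Real.rpow_nonneg hs.1.le _

theorem setLIntegral_letterMeasure_false {d : ℕ} {c e : ℕ → ℝ} (hc : ∀ N, 0 ≤ c N)
    (he : ∀ N, c N = 0 ∨ 0 < e N) {F : ℝ → ENNReal}
    (hF : ∀ s ∈ Set.Ioc (0 : ℝ) 1, F s = ∑' N, ENNReal.ofReal (c N * s ^ e N))
    {x : ℝ} (hx : x ∈ Set.Ioc (0 : ℝ) 1) :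
    ∫⁻ s in Set.Iio x, F s ∂letterMeasure d false =
      ∑' N, ENNReal.ofReal (c N / e N * x ^ e N) := by
  have h1 : ∀ s ∈ Set.Ioo 0 x, ENNReal.ofReal (letterWeight d false s) * F s =
      ∑' N, ENNReal.ofReal (c N * s ^ (e N - 1)) := by
    intro s hs
    rw [hF s ⟨hs.1, hs.2.le.trans hx.2⟩, ← ENNReal.tsum_mul_left]
    refine tsum_congr fun N => ?_
    rw [← ENNReal.ofReal_mul (by have := hs.1; simp only [letterWeight]; positivity),
      Real.rpow_sub_one hs.1.ne', letterWeight]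
    congr 1
    ring
  rw [setLIntegral_letterMeasure d false F hx.2, setLIntegral_congr_fun measurableSet_Ioo h1,
    lintegral_tsum fun N => by fun_prop]
  exact tsum_congr fun N => lintegral_Ioo_mul_rpow (hc N) (he N) hx.1.le

theorem setLIntegral_letterMeasure_true {d : ℕ} (hd : 0 < d) {c e : ℕ → ℝ} (hc : ∀ N, 0 ≤ c N)
    (he : ∀ N, c N = 0 ∨ 0 < e N) {F : ℝ → ENNReal}
    (hF : ∀ s ∈ Set.Ioc (0 : ℝ) 1, F s = ∑' N, ENNReal.ofReal (c N * s ^ (e N - 1)))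
    {x : ℝ} (hx : x ∈ Set.Ioc (0 : ℝ) 1) :
    ∫⁻ s in Set.Iio x, F s ∂letterMeasure d true =
      ∑' N, ∑' l : ℕ, ENNReal.ofReal (d * c N / (e N + d * l) * x ^ (e N + d * l)) := by
  have h1 : ∀ s ∈ Set.Ioo 0 x, ENNReal.ofReal (letterWeight d true s) * F s =
      ∑' N, ∑' l : ℕ, ENNReal.ofReal (d * c N * s ^ (e N + d * l - 1)) := by
    intro s hs
    have hs1 : s ^ d < 1 := pow_lt_one₀ hs.1.le (hs.2.trans_le hx.2) hd.ne'
    have hs0 : 0 < s ^ d := pow_pos hs.1 d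
    rw [hF s ⟨hs.1, hs.2.le.trans hx.2⟩, ← ENNReal.tsum_mul_left]
    refine tsum_congr fun N => ?_
    have h2 := hc N
    have h3 := hs.1
    rw [letterWeight, div_eq_mul_inv, ← tsum_geometric_of_lt_one hs0.le hs1, ← tsum_mul_left,
      ENNReal.ofReal_tsum_of_nonneg (fun l => by positivity)
        ((summable_geometric_of_lt_one hs0.le hs1).mul_left _), ← ENNReal.tsum_mul_right]
    refine tsum_congr fun l => ?_
    rw [← ENNReal.ofReal_mul (by positivity),
      show e N + d * l - 1 = (e N - 1) + ((d * l : ℕ) : ℝ) by push_cast; ring,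
      Real.rpow_add hs.1, Real.rpow_natCast, pow_mul]
    congr 1
    ring
  rw [setLIntegral_letterMeasure d true F hx.2, setLIntegral_congr_fun measurableSet_Ioo h1,
    lintegral_tsum fun N => (Measurable.tsum fun l => by fun_prop).aemeasurable]
  refine tsum_congr fun N => ?_
  rw [lintegral_tsum fun l => by fun_prop]
  refine tsum_congr fun l => lintegral_Ioo_mul_rpow (mul_nonneg (Nat.cast_nonneg _) (hc N)) ?_ hx.1.le
  rcases he N with h | h
  · exact Or.inl (by rw [h, mul_zero])
  · exact Or.inr (by positivity)

theorem nestedCoeff_eq_zero_or_pos {d : ℕ} (hd : 0 < d) (m : ℕ) (ms : List ℕ) {a : ℝ} (ha : 0 < a)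
    (N : ℕ) : nestedCoeff d (m :: ms) a N = 0 ∨ 0 < stepExponent ℝ d (ms.length + 1) N + a - 1 := by
  by_cases h : N < ms.length + 1
  · exact Or.inl (nestedCoeff_eq_zero _ _ _ h)
  · refine Or.inr ?_
    rw [stepExponent_eq_natCast hd (not_lt.1 h)]
    have : (1 : ℝ) ≤ ((N + (d - 1) * (N - (ms.length + 1)) : ℕ) : ℝ) := by
      exact_mod_cast (by omega : 1 ≤ N).trans (Nat.le_add_right _ _)
    linarith

theorem nestedCoeff_eq_zero_or_pos' {d : ℕ} (hd : 0 < d) (ms : List ℕ) {a : ℝ} (ha : 0 < a)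
    (N : ℕ) : nestedCoeff d ms a N = 0 ∨ 0 < stepExponent ℝ d ms.length N + a := by
  by_cases h : N < ms.length
  · exact Or.inl (nestedCoeff_eq_zero _ _ _ h)
  · refine Or.inr ?_
    rw [stepExponent_eq_natCast hd (not_lt.1 h)]
    positivity

theorem iteratedIntegral_cons (d : ℕ) (f : ℝ → ENNReal) (b : Bool) (w : List Bool) (x : ℝ) :
    iteratedIntegral d f (b :: w) x =
      ∫⁻ s in Set.Iio x, iteratedIntegral d f w s ∂letterMeasure d b :=
  rfl

/-- A letter `false` divides each term by its exponent; a letter `true` multiplies by a geometric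
series and integrates, adding a new outermost summation. The innermost `t ^ (a - 1)` shifts every
exponent by `a - 1`, which produces the Hurwitz parameter. -/
theorem iteratedIntegral_indexWord {d : ℕ} (hd : 0 < d) {ms : List ℕ} (hms : ∀ i ∈ ms, 0 < i)
    {a : ℝ} (ha : 0 < a) {x : ℝ} (hx : x ∈ Set.Ioc (0 : ℝ) 1) :
    iteratedIntegral d (fun t => ENNReal.ofReal (t ^ (a - 1))) (indexWord ms) x =
      ∑' N, ENNReal.ofReal
        (nestedCoeff d ms a N * x ^ (stepExponent ℝ d ms.length N + a - 1)) := by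
  induction ms generalizing x with
  | nil =>
    rw [tsum_eq_single 0 fun N hN => by simp [nestedCoeff, hN]]
    simp [nestedCoeff, stepExponent, indexWord, iteratedIntegral]
  | cons m ms ih =>
    obtain ⟨p, rfl⟩ := Nat.exists_eq_add_of_le' (hms m List.mem_cons_self)
    rw [indexWord_cons, List.length_cons]
    replace ih := fun {y} => @ih (fun i hi => hms i (List.mem_cons_of_mem _ hi)) y
    clear hms
    simp only [Nat.succ_eq_add_one, zero_add, Nat.add_sub_cancel]
    induction p generalizing x with
    | zero =>
      rw [List.replicate_zero, List.nil_append, iteratedIntegral_cons,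
        setLIntegral_letterMeasure_true hd (nestedCoeff_nonneg hd ms ha)
          (nestedCoeff_eq_zero_or_pos' hd ms ha) (fun s hs => ih hs) hx]
      -- Set `N = M + 1 + l`: increasing the depth by one and the index by `1 + l` raises the
      -- exponent by exactly `1 + d * l`.
      refine (Eq.trans ?_ (tsum_tsum_add_one_add fun M N =>
        ENNReal.ofReal (d * nestedCoeff d ms a M /
          (stepExponent ℝ d (ms.length + 1) N + a - 1) *
            x ^ (stepExponent ℝ d (ms.length + 1) N + a - 1)))).trans ?_
      · refine tsum_congr fun M => tsum_congr fun l => ?_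
        have : stepExponent ℝ d (ms.length + 1) (M + 1 + l) + a - 1 =
            stepExponent ℝ d ms.length M + a + d * l := by
          simp only [stepExponent]
          push_cast
          ring
        rw [this]
      · refine tsum_congr fun N => ?_
        rw [← ENNReal.ofReal_sum_of_nonneg]
        · rw [nestedCoeff, zero_add, pow_one, ← Finset.sum_mul, Finset.mul_sum]
          congr 2
          exact Finset.sum_congr rfl fun M _ => by ring
        · intro M hM
          rcases nestedCoeff_eq_zero_or_pos' hd ms ha M with h | h
          · simp [h]
          · have h1 := nestedCoeff_nonneg hd ms ha M
            have h2 : 0 ≤ stepExponent ℝ d (ms.length + 1) N + a - 1 := by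
              obtain ⟨l, rfl⟩ := Nat.exists_eq_add_of_le (Finset.mem_range.1 hM)
              have : stepExponent ℝ d (ms.length + 1) (M + 1 + l) + a - 1 =
                  stepExponent ℝ d ms.length M + a + d * l := by
                simp only [stepExponent]
                push_cast
                ring
              rw [Nat.succ_eq_add_one, this]
              positivity
            have := hx.1
            positivity
    | succ p ihp =>
      rw [List.replicate_succ, List.cons_append, iteratedIntegral_cons,
        setLIntegral_letterMeasure_false (nestedCoeff_nonneg hd _ ha)
          (nestedCoeff_eq_zero_or_pos hd _ ms ha) (fun s hs => ihp hs) hx]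
      refine tsum_congr fun N => ?_
      congr 2
      simp only [nestedCoeff]
      generalize stepExponent ℝ d (ms.length + 1) N + a - 1 = y
      rw [pow_succ y (p + 1)]
      ring

theorem iteratedIntegral_one_eq {d : ℕ} (hd : 0 < d) {ks : List ℕ} (hks : ∀ i ∈ ks, 0 < i)
    {x : ℝ} (hx : x ∈ Set.Ioo (0 : ℝ) 1) :
    (Summable fun N => x ^ (d * N - (d - 1) * ks.length) * nestedCoeff d ks (1 : ℝ) N) ∧
    iteratedIntegral d (fun _ => 1) (indexWord ks) x =
      ENNReal.ofReal (∑' N, x ^ (d * N - (d - 1) * ks.length) * nestedCoeff d ks (1 : ℝ) N) := by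
  have hx0 := hx.1
  -- The truncated subtraction is harmless: for smaller `N` the coefficient is zero.
  have key : ∀ N, ks.length ≤ N → d * N - (d - 1) * ks.length = N + (d - 1) * (N - ks.length) := by
    intro N hN
    obtain ⟨e, rfl⟩ := Nat.exists_eq_add_of_le' hd
    obtain ⟨s, rfl⟩ := Nat.exists_eq_add_of_le hN
    simp only [Nat.succ_eq_add_one, zero_add, Nat.add_sub_cancel, Nat.add_sub_cancel_left]
    rw [Nat.sub_eq_iff_eq_add (by nlinarith)]
    ring
  have hs : Summable fun N => x ^ (d * N - (d - 1) * ks.length) * nestedCoeff d ks (1 : ℝ) N := by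
    refine Summable.of_nonneg_of_le (fun N => ?_) (fun N => ?_)
      (summable_nestedCoeff_mul_pow hd hks hx.1.le hx.2)
    · exact mul_nonneg (by positivity) (nestedCoeff_nonneg hd _ one_pos N)
    · by_cases h : N < ks.length
      · rw [nestedCoeff_eq_zero _ _ _ h, mul_zero, zero_mul]
      · rw [key N (not_lt.1 h), mul_comm]
        exact mul_le_mul_of_nonneg_left
          (pow_le_pow_of_le_one hx.1.le hx.2.le (Nat.le_add_right _ _))
          (nestedCoeff_nonneg hd _ one_pos N)
  refine ⟨hs, ?_⟩
  rw [ENNReal.ofReal_tsum_of_nonneg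
    (fun N => mul_nonneg (by positivity) (nestedCoeff_nonneg hd _ one_pos N)) hs]
  have h1 : (fun _ : ℝ => (1 : ENNReal)) = fun t => ENNReal.ofReal (t ^ ((1 : ℝ) - 1)) := by
    simp
  rw [h1, iteratedIntegral_indexWord hd hks one_pos ⟨hx.1, hx.2.le⟩]
  refine tsum_congr fun N => ?_
  by_cases h : N < ks.length
  · rw [nestedCoeff_eq_zero _ _ _ h, mul_zero, zero_mul]
  · rw [key N (not_lt.1 h), stepExponent_eq_natCast hd (not_lt.1 h), add_sub_cancel_right,
      Real.rpow_natCast, mul_comm]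

/-! ### Absolute convergence over tuples; `Li` and `A` as power series -/

theorem DecTuple.length_sub_le {r : ℕ} (n : DecTuple r) (i : Fin r) : r - i ≤ n.1 i := by
  obtain ⟨n, h1, h2⟩ := n
  change r - i ≤ n i
  induction r with
  | zero => exact i.elim0
  | succ r ih =>
    cases i using Fin.lastCases with
    | last =>
      have := h2 (Fin.last r)
      simp only [Fin.val_last]
      omega
    | cast i =>
      have h3 := ih i (fun j => n j.succ)
        (fun j j' h => h1 (Fin.succ_lt_succ_iff.2 h)) (fun j => h2 _)
      have h4 := h1 (Fin.castSucc_lt_succ (i := i))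
      simp only [Fin.val_castSucc] at h3 ⊢
      omega

/-- One natural number serves all rings, so that complex factors can be compared with real ones. -/
theorem exists_stepExponent_eq {d : ℕ} (hd : 0 < d) {r : ℕ} (n : DecTuple r) (i : Fin r) :
    ∃ q : ℕ, 1 ≤ q ∧ ∀ (R : Type) [Ring R], (stepExponent R d (r - i) (n.1 i) : R) = q :=
  ⟨_, (n.2.2 i).trans_le (Nat.le_add_right _ _),
    fun _ _ => stepExponent_eq_natCast hd (n.length_sub_le i)⟩

theorem nestedFactor_nonneg {d : ℕ} (hd : 0 < d) (ms : List ℕ) (n : DecTuple ms.length)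
    (i : Fin ms.length) : 0 ≤ nestedFactor d ms (1 : ℝ) i (n.1 i) := by
  obtain ⟨q, -, h⟩ := exists_stepExponent_eq hd n i
  rw [nestedFactor, h, add_sub_cancel_right]
  positivity

theorem norm_nestedFactor_le {d : ℕ} (hd : 0 < d) (ms : List ℕ) {a : ℂ} {δ : ℝ} (hδ : 0 < δ)
    (h : ∀ q : ℕ, 1 ≤ q → δ * q ≤ ‖(q : ℂ) + a - 1‖) (n : DecTuple ms.length) (i : Fin ms.length) :
    ‖nestedFactor d ms a i (n.1 i)‖ ≤ (1 / δ) ^ ms.get i * nestedFactor d ms (1 : ℝ) i (n.1 i) := by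
  obtain ⟨q, hq, e⟩ := exists_stepExponent_eq hd n i
  have hq' : (0 : ℝ) < q := by exact_mod_cast hq
  rw [nestedFactor, nestedFactor, e, e, add_sub_cancel_right, norm_div, norm_pow,
    Complex.norm_natCast, one_div, inv_pow, inv_mul_eq_div, div_div, ← mul_pow]
  gcongr
  simpa [mul_comm] using h q hq

theorem summable_nestedFactor {d : ℕ} (hd : 0 < d) {ms : List ℕ} (hms : IsAdmissible ms)
    {a : ℂ} (ha : ∀ q : ℕ, 1 ≤ q → (q : ℂ) + a - 1 ≠ 0) :
    Summable fun n : DecTuple ms.length => ∏ i, nestedFactor d ms a i (n.1 i) := by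
  obtain ⟨δ, hδ, h⟩ := exists_mul_le_norm ha
  have hr : Summable fun n : DecTuple ms.length => ∏ i, nestedFactor d ms (1 : ℝ) i (n.1 i) :=
    (hasSum_decTuple_of_nonneg
      (fun n => Finset.prod_nonneg fun i _ => nestedFactor_nonneg hd ms n i)
      (nestedCoeff_nonneg hd ms one_pos) (summable_nestedCoeff hd hms)
      (decSum_nestedFactor d ms 1)).summable
  refine Summable.of_norm_bounded (hr.mul_left (∏ i, (1 / δ) ^ ms.get i)) fun n => ?_
  rw [norm_prod, ← Finset.prod_mul_distrib]
  exact Finset.prod_le_prod (fun _ _ => norm_nonneg _)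
    fun i _ => norm_nestedFactor_le hd ms hδ (h a (Metric.mem_ball_self hδ)) n i

theorem summable_hurwitzMTVTerm {ms : List ℕ} (hms : IsAdmissible ms)
    {a : ℂ} (ha : ∀ q : ℕ, 1 ≤ q → (q : ℂ) + a - 1 ≠ 0) : Summable (hurwitzMTVTerm ms a) := by
  rw [funext (hurwitzMTVTerm_eq ms a)]
  exact summable_nestedFactor two_pos hms ha

theorem hurwitzMTV_eq {ms : List ℕ} (hms : IsAdmissible ms)
    {a : ℂ} (ha : ∀ q : ℕ, 1 ≤ q → (q : ℂ) + a - 1 ≠ 0) :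
    hurwitzMTV ms a = ∑' N, nestedCoeff 2 ms a N := by
  have h := tendsto_decSum (summable_nestedFactor two_pos hms ha)
  rw [funext (decSum_nestedFactor 2 ms a)] at h
  rw [hurwitzMTV, funext (hurwitzMTVTerm_eq ms a)]
  exact tendsto_nhds_unique h ((summable_nestedCoeff_complex two_pos hms ha).hasSum.tendsto_sum_nat.comp
    (tendsto_add_atTop_nat 1))

theorem tsum_decTuple_eq {d : ℕ} (hd : 0 < d) {ks : List ℕ} (hne : ks ≠ [])
    (hks : ∀ i ∈ ks, 0 < i) {x : ℝ} (hx : x ∈ Set.Ioo (0 : ℝ) 1) :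
    ∑' n : DecTuple ks.length, ∏ i : Fin ks.length,
      (if (i : ℕ) = 0 then x ^ (d * n.1 i - (d - 1) * ks.length) else 1) *
        nestedFactor d ks (1 : ℝ) i (n.1 i) =
      ∑' N, x ^ (d * N - (d - 1) * ks.length) * nestedCoeff d ks (1 : ℝ) N := by
  have hs := (iteratedIntegral_one_eq hd hks hx).1
  have hx0 := hx.1
  have hw : ∀ φ : ℕ → ℝ, ∀ N, decSum ks.length
      (fun i n => (if (i : ℕ) = 0 then φ n else 1) * nestedFactor d ks (1 : ℝ) i n) N =
      ∑ M ∈ Finset.range (N + 1), φ M * nestedCoeff d ks (1 : ℝ) M := by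
    obtain ⟨m, t, rfl⟩ := List.exists_cons_of_ne_nil hne
    exact decSum_weighted_nestedFactor d m t (1 : ℝ)
  refine (hasSum_decTuple_of_nonneg (fun n => Finset.prod_nonneg fun i _ =>
    mul_nonneg ?_ (nestedFactor_nonneg hd _ n i))
    (fun N => mul_nonneg ?_ (nestedCoeff_nonneg hd _ one_pos N)) hs
    (hw fun N => x ^ (d * N - (d - 1) * ks.length))).tsum_eq
  · split_ifs <;> positivity
  · positivity

theorem polylog_eq {ks : List ℕ} (hne : ks ≠ []) (hks : ∀ i ∈ ks, 0 < i)
    {x : ℝ} (hx : x ∈ Set.Ioo (0 : ℝ) 1) :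
    polylog ks x = ∑' N, x ^ (1 * N - (1 - 1) * ks.length) * nestedCoeff 1 ks (1 : ℝ) N := by
  rw [← tsum_decTuple_eq one_pos hne hks hx, polylog, multiPolylog]
  refine tsum_congr fun n => Finset.prod_congr rfl fun i _ => ?_
  split_ifs <;> simp [nestedFactor, stepExponent, div_eq_mul_inv]

theorem kanekoTsumuraA_eq {ks : List ℕ} (hne : ks ≠ []) (hks : ∀ i ∈ ks, 0 < i)
    {x : ℝ} (hx : x ∈ Set.Ioo (0 : ℝ) 1) :
    kanekoTsumuraA ks x =
      ∑' N, x ^ (2 * N - (2 - 1) * ks.length) * nestedCoeff 2 ks (1 : ℝ) N := by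
  rw [← tsum_decTuple_eq two_pos hne hks hx, kanekoTsumuraA, ← tsum_mul_left]
  refine tsum_congr fun n => ?_
  rw [show (2 : ℝ) ^ ks.length = ∏ _i : Fin ks.length, 2 by simp, ← Finset.prod_mul_distrib]
  refine Finset.prod_congr rfl fun i _ => ?_
  have h : 2 * (n.1 i : ℝ) - ks.length + (i : ℕ) = stepExponent ℝ 2 (ks.length - i) (n.1 i) := by
    rw [stepExponent, Nat.cast_sub i.2.le]
    push_cast
    ring
  rw [h, nestedFactor, add_sub_cancel_right]
  split_ifs <;> simp <;> ring

/-! ### The moment generating function of `log τ` -/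

/-- The measure on `(0, 1)` whose density is `1 / x` times the iterated integral of `1` along the
word of `ks`. -/
noncomputable def polylogMeasure (d : ℕ) (ks : List ℕ) : Measure ℝ :=
  (volume.restrict (Set.Ioo 0 1)).withDensity fun x =>
    ENNReal.ofReal (letterWeight d false x) * iteratedIntegral d (fun _ => 1) (indexWord ks) x

theorem measurable_polylogMeasure_density (d : ℕ) (ks : List ℕ) : Measurable fun x =>
    ENNReal.ofReal (letterWeight d false x) *
      iteratedIntegral d (fun _ => 1) (indexWord ks) x :=
  (measurable_letterWeight d false).ennreal_ofReal.mul
    (measurable_iteratedIntegral d measurable_const _)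

theorem lintegral_polylogMeasure (d : ℕ) (ks : List ℕ) {g : ℝ → ENNReal} (hg : Measurable g) :
    ∫⁻ x, g x ∂polylogMeasure d ks =
      ∫⁻ x, iteratedIntegral d (fun _ => 1) (indexWord ks) x * g x ∂letterMeasure d false := by
  rw [polylogMeasure, lintegral_withDensity_eq_lintegral_mul _
    (measurable_polylogMeasure_density d ks) hg, lintegral_letterMeasure]
  simp only [Pi.mul_apply, mul_assoc]

/-- The substitution `x = τ t` turns `dx / x` into the letter `true` and `τ(x) ^ z` into `t ^ z`;
transporting the word then gives the word of `m` with innermost function `t ^ (a - 1)`, `a = 1 + z`.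
-/
theorem IsDualInvolution.lintegral_exp_log {d : ℕ} {τ : ℝ → ℝ} (h : IsDualInvolution d τ)
    (hd : 0 < d) {ks : List ℕ} (hne : ks ≠ []) {z : ℝ} (hz : -1 < z) :
    ∫⁻ x, ENNReal.ofReal (Real.exp (z * Real.log (τ x))) ∂polylogMeasure d ks =
      ENNReal.ofReal
        (∑' N, nestedCoeff d (incHead (hoffmanDual ks.reverse)) (1 + z) N) := by
  have hadm := isAdmissible_incHead_hoffmanDual hne
  have ha : 0 < 1 + z := by linarith
  have hτ := h.measurable
  have hpow : Measurable fun t : ℝ => ENNReal.ofReal (t ^ (1 + z - 1)) := by fun_prop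
  have hs : Summable (nestedCoeff d (incHead (hoffmanDual ks.reverse)) (1 + z)) := by
    have hne : ∀ q : ℕ, 1 ≤ q → (q : ℂ) + ((1 + z : ℝ) : ℂ) - 1 ≠ 0 := by
      intro q hq h0
      have h1 : (q : ℝ) + (1 + z) - 1 = 0 := by exact_mod_cast h0
      have h2 : (1 : ℝ) ≤ q := by exact_mod_cast hq
      linarith
    have h2 := summable_nestedCoeff_complex hd hadm hne
    rw [← Complex.summable_ofReal]
    exact h2.congr fun N => (ofReal_nestedCoeff d _ _ N).symm
  rw [lintegral_polylogMeasure d ks (by fun_prop)]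
  have h1 := h.lintegral_comp true fun x => iteratedIntegral d (fun _ => 1) (indexWord ks) x *
    ENNReal.ofReal (Real.exp (z * Real.log (τ x)))
  rw [Bool.not_true] at h1
  rw [← h1]
  have h2 : ∀ᵐ x ∂letterMeasure d true,
      iteratedIntegral d (fun _ => 1) (indexWord ks) (τ x) *
        ENNReal.ofReal (Real.exp (z * Real.log (τ (τ x)))) =
      iteratedIntegral d (fun _ => 1) (indexWord ks) (τ x) *
        ENNReal.ofReal (x ^ (1 + z - 1)) := by
    filter_upwards [ae_mem_Ioo_letterMeasure d true] with x hx
    rw [h.involutive x hx, add_sub_cancel_left, Real.rpow_def_of_pos hx.1, mul_comm z]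
  rw [lintegral_congr_ae h2, h.lintegral_iteratedIntegral_one_comp hpow,
    ← indexWord_incHead_hoffmanDual hne,
    iteratedIntegral_indexWord hd hadm.pos ha ⟨one_pos, le_rfl⟩,
    ENNReal.ofReal_tsum_of_nonneg (nestedCoeff_nonneg hd _ ha) hs]
  simp only [Real.one_rpow, mul_one]

open ProbabilityTheory in
theorem IsDualInvolution.mgf_eq {d : ℕ} {τ : ℝ → ℝ} (h : IsDualInvolution d τ)
    (hd : 0 < d) {ks : List ℕ} (hne : ks ≠ []) {z : ℝ} (hz : -1 < z) :
    Integrable (fun x => Real.exp (z * Real.log (τ x))) (polylogMeasure d ks) ∧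
    mgf (fun x => Real.log (τ x)) (polylogMeasure d ks) z =
      ∑' N, nestedCoeff d (incHead (hoffmanDual ks.reverse)) (1 + z) N := by
  have hτ := h.measurable
  have hl := h.lintegral_exp_log hd hne hz
  have hm : AEStronglyMeasurable (fun x => Real.exp (z * Real.log (τ x))) (polylogMeasure d ks) :=
    Measurable.aestronglyMeasurable (by fun_prop)
  have h0 : 0 ≤ᵐ[polylogMeasure d ks] fun x => Real.exp (z * Real.log (τ x)) :=
    ae_of_all _ fun x => (Real.exp_pos _).le
  refine ⟨⟨hm, ?_⟩, ?_⟩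
  · rw [hasFiniteIntegral_iff_ofReal h0, hl]
    exact ENNReal.ofReal_lt_top
  · rw [mgf, integral_eq_lintegral_of_nonneg_ae h0 hm, hl,
      ENNReal.toReal_ofReal (tsum_nonneg fun N => nestedCoeff_nonneg hd _ (by linarith) N)]

theorem add_sub_one_ne_zero_of_re_pos {a : ℂ} (ha : 0 < a.re) (q : ℕ) (hq : 1 ≤ q) :
    (q : ℂ) + a - 1 ≠ 0 := by
  intro h
  have h1 := congrArg Complex.re h
  have h2 : (1 : ℝ) ≤ q := by exact_mod_cast hq
  simp only [Complex.sub_re, Complex.add_re, Complex.natCast_re, Complex.one_re,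
    Complex.zero_re] at h1
  linarith

open ProbabilityTheory in
theorem IsDualInvolution.mem_interior_integrableExpSet {d : ℕ} {τ : ℝ → ℝ}
    (h : IsDualInvolution d τ) (hd : 0 < d) {ks : List ℕ} (hne : ks ≠ []) {z : ℝ} (hz : -1 < z) :
    z ∈ interior (integrableExpSet (fun x => Real.log (τ x)) (polylogMeasure d ks)) :=
  mem_interior.2 ⟨Set.Ioi (-1), fun _ hy => (h.mgf_eq hd hne hy).1, isOpen_Ioi, hz⟩

-- The identity theorem on the half-plane `Re z > -1`, where both sides are analytic and agree on
-- the real axis.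
open ProbabilityTheory in
theorem IsDualInvolution.complexMGF_eq {d : ℕ} {τ : ℝ → ℝ} (h : IsDualInvolution d τ)
    (hd : 0 < d) {ks : List ℕ} (hne : ks ≠ []) {z : ℂ} (hz : -1 < z.re) :
    complexMGF (fun x => Real.log (τ x)) (polylogMeasure d ks) z =
      nestedSumDeriv d (incHead (hoffmanDual ks.reverse)) 0 (1 + z) := by
  have hadm := isAdmissible_incHead_hoffmanDual hne
  have hU : IsOpen {z : ℂ | -1 < z.re} := isOpen_lt continuous_const Complex.continuous_re
  have hf : AnalyticOnNhd ℂ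
      (complexMGF (fun x => Real.log (τ x)) (polylogMeasure d ks)) {z : ℂ | -1 < z.re} :=
    analyticOnNhd_complexMGF.mono fun w hw => h.mem_interior_integrableExpSet hd hne hw
  have hg : AnalyticOnNhd ℂ (fun z =>
      nestedSumDeriv d (incHead (hoffmanDual ks.reverse)) 0 (1 + z)) {z : ℂ | -1 < z.re} := by
    refine DifferentiableOn.analyticOnNhd (fun w hw => ?_) hU
    have hw' : -1 < w.re := hw
    have h1 := hasDerivAt_nestedSumDeriv hd hadm 0 (a := 1 + w)
      (add_sub_one_ne_zero_of_re_pos (by simp; linarith))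
    exact (h1.comp_const_add 1 w).differentiableAt.differentiableWithinAt
  have hconn : IsPreconnected {z : ℂ | -1 < z.re} := (convex_halfSpace_re_gt (-1)).isPreconnected
  have hreal : ∀ x : ℝ, -1 < x →
      complexMGF (fun x => Real.log (τ x)) (polylogMeasure d ks) (x : ℂ) =
      nestedSumDeriv d (incHead (hoffmanDual ks.reverse)) 0 (1 + (x : ℂ)) := by
    intro x hx
    rw [complexMGF_ofReal, (h.mgf_eq hd hne hx).2, nestedSumDeriv_zero, Complex.ofReal_tsum]
    exact tsum_congr fun N => by rw [ofReal_nestedCoeff]; push_cast; rfl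
  refine hf.eqOn_of_preconnected_of_frequently_eq hg hconn (z₀ := 0) (by simp) ?_ hz
  -- The real points `1 / (n + 1)` accumulate at `0` inside the half-plane.
  have hseq : Tendsto (fun n : ℕ => (((1 / ((n : ℝ) + 1) : ℝ)) : ℂ)) atTop (𝓝[≠] 0) := by
    refine tendsto_nhdsWithin_iff.2 ⟨?_, Eventually.of_forall fun n => ?_⟩
    · have := (Complex.continuous_ofReal.tendsto 0).comp
        (tendsto_one_div_add_atTop_nhds_zero_nat (𝕜 := ℝ))
      rwa [Complex.ofReal_zero] at this
    · have : (1 / ((n : ℝ) + 1) : ℝ) ≠ 0 := by positivity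
      exact Complex.ofReal_ne_zero.2 this
  refine hseq.frequently (Frequently.of_forall fun n => hreal _ ?_)
  have : (0 : ℝ) < 1 / ((n : ℝ) + 1) := by positivity
  linarith

/-- Each derivative in `z` brings down one `log τ` under the integral and a factor `-(k + 1)` on the
series side, which builds up `(-1) ^ k * k!`; uniqueness of derivatives closes the induction. -/
theorem IsDualInvolution.integral_pow_mul_exp {d : ℕ} {τ : ℝ → ℝ} (h : IsDualInvolution d τ)
    (hd : 0 < d) {ks : List ℕ} (hne : ks ≠ []) (k : ℕ) {z : ℂ} (hz : -1 < z.re) :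
    ∫ x, (Real.log (τ x) : ℂ) ^ k * Complex.exp (z * Real.log (τ x)) ∂polylogMeasure d ks =
      (-1) ^ k * (k.factorial : ℂ) *
        nestedSumDeriv d (incHead (hoffmanDual ks.reverse)) k (1 + z) := by
  have hadm := isAdmissible_incHead_hoffmanDual hne
  have hU : IsOpen {z : ℂ | -1 < z.re} := isOpen_lt continuous_const Complex.continuous_re
  induction k generalizing z with
  | zero =>
    simpa [ProbabilityTheory.complexMGF] using h.complexMGF_eq hd hne hz
  | succ k ih =>
    have h1 := ProbabilityTheory.hasDerivAt_integral_pow_mul_exp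
      (h.mem_interior_integrableExpSet hd hne hz) k
    have h2 := ((hasDerivAt_nestedSumDeriv hd hadm k (a := 1 + z)
      (add_sub_one_ne_zero_of_re_pos (by simp; linarith))).comp_const_add 1 z).const_mul
        ((-1) ^ k * (k.factorial : ℂ))
    have h3 := h1.congr_of_eventuallyEq
      (Filter.eventuallyEq_of_mem (hU.mem_nhds hz) fun w hw => (ih hw).symm)
    rw [h3.unique h2, Nat.factorial_succ]
    push_cast
    ring

theorem IsDualInvolution.intervalIntegral_eq {d : ℕ} {τ : ℝ → ℝ} (h : IsDualInvolution d τ)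
    (hd : 0 < d) {ks : List ℕ} (hne : ks ≠ []) (hks : ∀ i ∈ ks, 0 < i) {f : ℝ → ℝ}
    (hf : ∀ x ∈ Set.Ioo (0 : ℝ) 1,
      f x = ∑' N, x ^ (d * N - (d - 1) * ks.length) * nestedCoeff d ks (1 : ℝ) N)
    (k : ℕ) {α : ℂ} (hα : α.re < 1) :
    IntervalIntegrable (fun x : ℝ =>
      (f x : ℂ) * (Real.log (τ x) : ℂ) ^ k / ((x : ℂ) * ((τ x : ℝ) : ℂ) ^ α)) volume 0 1 ∧
    ∫ x in (0 : ℝ)..1, (f x : ℂ) * (Real.log (τ x) : ℂ) ^ k / ((x : ℂ) * ((τ x : ℝ) : ℂ) ^ α) =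
      (-1) ^ k * (k.factorial : ℂ) *
        nestedSumDeriv d (incHead (hoffmanDual ks.reverse)) k (1 - α) := by
  have hz : -1 < (-α).re := by
    rw [Complex.neg_re]
    linarith
  have hL : ∀ x ∈ Set.Ioo (0 : ℝ) 1,
      iteratedIntegral d (fun _ => 1) (indexWord ks) x = ENNReal.ofReal (f x) ∧ 0 ≤ f x := by
    intro x hx
    have hx0 := hx.1
    rw [hf x hx]
    exact ⟨(iteratedIntegral_one_eq hd hks hx).2,
      tsum_nonneg fun N => mul_nonneg (by positivity) (nestedCoeff_nonneg hd _ one_pos N)⟩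
  have hint := ProbabilityTheory.integrable_pow_mul_cexp_of_re_mem_interior_integrableExpSet
    (h.mem_interior_integrableExpSet hd hne hz) k
  have hval := h.integral_pow_mul_exp hd hne k hz
  have hm := measurable_polylogMeasure_density d ks
  have hfin : ∀ᵐ x ∂volume.restrict (Set.Ioo (0 : ℝ) 1), ENNReal.ofReal (letterWeight d false x) *
      iteratedIntegral d (fun _ => 1) (indexWord ks) x < ⊤ := by
    filter_upwards [ae_restrict_mem measurableSet_Ioo] with x hx
    rw [(hL x hx).1]
    exact ENNReal.mul_lt_top ENNReal.ofReal_lt_top ENNReal.ofReal_lt_top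
  rw [polylogMeasure, integrable_withDensity_iff_integrable_smul' hm hfin] at hint
  rw [polylogMeasure, integral_withDensity_eq_integral_toReal_smul hm hfin] at hval
  -- With `z = -α`, the density `f x / x` times `exp (-α log τ)` is the integrand, as `τ x > 0`
  -- makes the complex power the exponential of the real logarithm.
  have hcongr : ∀ x ∈ Set.Ioo (0 : ℝ) 1, (ENNReal.ofReal (letterWeight d false x) *
        iteratedIntegral d (fun _ => 1) (indexWord ks) x).toReal •
      ((Real.log (τ x) : ℂ) ^ k * Complex.exp (-α * Real.log (τ x))) =
      (f x : ℂ) * (Real.log (τ x) : ℂ) ^ k / ((x : ℂ) * ((τ x : ℝ) : ℂ) ^ α) := by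
    intro x hx
    have hτ : ((τ x : ℝ) : ℂ) ≠ 0 := by exact_mod_cast (h.mapsTo x hx).1.ne'
    rw [(hL x hx).1, ENNReal.toReal_mul, ENNReal.toReal_ofReal (hL x hx).2,
      ENNReal.toReal_ofReal (letterWeight_nonneg d false hx), Complex.cpow_def_of_ne_zero hτ,
      ← Complex.ofReal_log (h.mapsTo x hx).1.le, neg_mul, Complex.exp_neg, mul_comm α,
      Complex.real_smul]
    simp only [letterWeight]
    push_cast
    field_simp
  have hae := (ae_restrict_iff' (μ := (volume : Measure ℝ)) measurableSet_Ioo).2 (ae_of_all _ hcongr)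
  constructor
  · rw [intervalIntegrable_iff_integrableOn_Ioo_of_le zero_le_one]
    exact hint.congr hae
  · rw [intervalIntegral.integral_of_le zero_le_one, ← restrict_Ioo_eq_restrict_Ioc,
      ← integral_congr_ae hae, hval, ← sub_eq_add_neg]

/-! ### Continuation to `ℂ ∖ ℕ` and the theorem -/

theorem natCast_add_sub_one_ne_zero {α : ℂ} (hα : α ∈ complexMinusPosNat) (q : ℕ) (hq : 1 ≤ q) :
    (q : ℂ) + (1 - α) - 1 ≠ 0 := fun h => hα q hq (by linear_combination -h)

theorem differentiableOn_nestedSumDeriv {d : ℕ} (hd : 0 < d) {ms : List ℕ} (hms : IsAdmissible ms)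
    (k : ℕ) (c : ℂ) :
    DifferentiableOn ℂ (fun α => c * nestedSumDeriv d ms k (1 - α)) complexMinusPosNat :=
  fun α hα => (((hasDerivAt_nestedSumDeriv hd hms k
    (natCast_add_sub_one_ne_zero hα)).comp_const_sub 1 α).const_mul
      c).differentiableAt.differentiableWithinAt

theorem mainTheorem1 (ks : List ℕ) (hne : ks ≠ []) (hpos : ∀ i ∈ ks, 0 < i)
    (k : ℕ) (hk : 0 < k) :
    (∃ F : ℂ → ℂ, DifferentiableOn ℂ F complexMinusPosNat ∧
      (∀ α : ℂ, α.re < 1 →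
        IntervalIntegrable (polylogIntegrand ks k α) volume 0 1 ∧
        F α = ∫ x in (0 : ℝ)..1, polylogIntegrand ks k α x) ∧
      ∀ α ∈ complexMinusPosNat,
        (∀ j ∈ Finset.Nat.antidiagonalTuple (ks.sum + 1 - ks.length) k,
          Tendsto
            (hurwitzHarmonicSum
              (addLists (incHead (hoffmanDual ks.reverse)) (List.ofFn j)) (1 - α)) atTop
            (𝓝 (hurwitzMZV
              (addLists (incHead (hoffmanDual ks.reverse)) (List.ofFn j)) (1 - α)))) ∧
        F α = (-1) ^ k * (k.factorial : ℂ) *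
          ∑ j ∈ Finset.Nat.antidiagonalTuple (ks.sum + 1 - ks.length) k,
            (multiBinom (incHead (hoffmanDual ks.reverse)) (List.ofFn j) : ℂ) *
              hurwitzMZV
                (addLists (incHead (hoffmanDual ks.reverse)) (List.ofFn j)) (1 - α)) ∧
    (∃ G : ℂ → ℂ, DifferentiableOn ℂ G complexMinusPosNat ∧
      (∀ α : ℂ, α.re < 1 →
        IntervalIntegrable (kanekoTsumuraIntegrand ks k α) volume 0 1 ∧
        G α = ∫ x in (0 : ℝ)..1, kanekoTsumuraIntegrand ks k α x) ∧
      ∀ α ∈ complexMinusPosNat,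
        (∀ j ∈ Finset.Nat.antidiagonalTuple (ks.sum + 1 - ks.length) k,
          Summable
            (hurwitzMTVTerm
              (addLists (incHead (hoffmanDual ks.reverse)) (List.ofFn j)) (1 - α))) ∧
        G α = (-1) ^ k * (k.factorial : ℂ) *
          ∑ j ∈ Finset.Nat.antidiagonalTuple (ks.sum + 1 - ks.length) k,
            (multiBinom (incHead (hoffmanDual ks.reverse)) (List.ofFn j) : ℂ) *
              hurwitzMTV
                (addLists (incHead (hoffmanDual ks.reverse)) (List.ofFn j)) (1 - α)) := by
  have hadm := isAdmissible_incHead_hoffmanDual hne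
  rw [← length_incHead_hoffmanDual hne hpos]
  constructor
  · refine ⟨fun α => (-1) ^ k * (k.factorial : ℂ) *
      nestedSumDeriv 1 (incHead (hoffmanDual ks.reverse)) k (1 - α),
      differentiableOn_nestedSumDeriv one_pos hadm k _, fun α hα => ?_, fun α hα => ⟨?_, ?_⟩⟩
    · have := isDualInvolution_one_sub.intervalIntegral_eq one_pos hne hpos
        (fun x hx => polylog_eq hne hpos hx) k hα
      exact ⟨this.1, this.2.symm⟩
    · intro j _
      rw [hurwitzMZV_eq (hadm.addLists j) (natCast_add_sub_one_ne_zero hα)]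
      exact tendsto_hurwitzHarmonicSum (hadm.addLists j) (natCast_add_sub_one_ne_zero hα)
    · beta_reduce
      rw [nestedSumDeriv_eq one_pos hadm k (natCast_add_sub_one_ne_zero hα)]
      congr 1
      exact Finset.sum_congr rfl fun j _ => by
        rw [hurwitzMZV_eq (hadm.addLists j) (natCast_add_sub_one_ne_zero hα)]
  · refine ⟨fun α => (-1) ^ k * (k.factorial : ℂ) *
      nestedSumDeriv 2 (incHead (hoffmanDual ks.reverse)) k (1 - α),
      differentiableOn_nestedSumDeriv two_pos hadm k _, fun α hα => ?_, fun α hα => ⟨?_, ?_⟩⟩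
    · have := isDualInvolution_cayley.intervalIntegral_eq two_pos hne hpos
        (fun x hx => kanekoTsumuraA_eq hne hpos hx) k hα
      exact ⟨this.1, this.2.symm⟩
    · exact fun j _ =>
        summable_hurwitzMTVTerm (hadm.addLists j) (natCast_add_sub_one_ne_zero hα)
    · beta_reduce
      rw [nestedSumDeriv_eq two_pos hadm k (natCast_add_sub_one_ne_zero hα)]
      congr 1
      exact Finset.sum_congr rfl fun j _ => by
        rw [hurwitzMTV_eq (hadm.addLists j) (natCast_add_sub_one_ne_zero hα)]
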